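/- Let $(R,\mathfrak m)$ be a local ring of characteristic $p>0$. Its Hilbert--Kunz multiplicity is $$e_{HK}(R)=\lim_{e\to\infty}\frac{\lambda(R/\mathfrak m^{[p^e]})}{p^{e\dim R}},$$ where $\lambda$ denotes length and $\mathfrak m^{[p^e]}$ is the ideal generated by all $p^e$-th powers of elements of $\mathfrak m$. For a prime $p>2$ and $d\ge 0$ put $A_{p,d}=\mathbb F_p[[x_0,\dots,x_d]]/(x_0^2+\cdots+x_d^2)$. For an integer $a\ge 1$ let $T_a$ and $N_a$ be the $(2a+1)\times(2a+1)$ matrices with rows and columns indexed by $1,\dots,2a+1$ and entries $$(T_a)_{ij}=\begin{cases}2 & \text{if } i+j\le a+1 \text{ or } i+j\ge 3a+3,\\ 0 & \text{if } |i-j|>a,\\ 1 & \text{otherwise,}\end{cases}\qquad (N_a)_{ij}=\begin{cases}0 & \text{if } i+j\le a+1 \text{ or } i+j\ge 3a+3 \text{ or } |i-j|>a,\\ 1 & \text{otherwise.}\end{cases}$$ **Corollary.** Let $k$ be a field of characteristic $p>2$, let $a=(p-1)/2$ and let $d\ge 0$. Then the limits defining the Hilbert--Kunz multiplicities of $A_{p,d}$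 and of $k[[x_0,\dots,x_d]]/(x_0^2+\cdots+x_d^2)$ exist, the denominator below is nonzero, and $$e_{HK}(A_{p,d})=e_{HK}\bigl(k[[x_0,\dots,x_d]]/(x_0^2+\cdots+x_d^2)\bigr)=1+\frac{[T_a^{d+1}]_{(1,1)}-p^d}{p^d-[N_a^{d+1}]_{(1,1)}},$$ where $[M]_{(1,1)}$ denotes the $(1,1)$-entry of a matrix $M$. -/

import Mathlib

open Filter Topology

namespace HilbertKunz

/-- The ideal generated by the `q`-th powers of all elements of `I`; for `q = p ^ e` in
characteristic `p` this is the Frobenius power `I^[q]`. -/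
def frobeniusPower {R : Type*} [CommRing R] (I : Ideal R) (q : ℕ) : Ideal R :=
  Ideal.span {y | ∃ x ∈ I, y = x ^ q}

/-- The length of the `R`-module `R / m^[p^e]`, where `m` is the maximal ideal of `R`. -/
noncomputable def hkLength (p : ℕ) (R : Type*) [CommRing R] [IsLocalRing R] [CharP R p]
    (e : ℕ) : ℕ∞ :=
  Module.length R (R ⧸ frobeniusPower (IsLocalRing.maximalIdeal R) (p ^ e))

/-- `R` is a local ring of characteristic `p` and finite Krull dimension `n`, all the lengths
`λ(R / m^[p^e])` are finite, and `λ(R / m^[p^e]) / p^(e n)` converges to `c`. -/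
def HasHKMultiplicity (p : ℕ) (R : Type*) [CommRing R] [IsLocalRing R] [CharP R p]
    (c : ℝ) : Prop :=
  ∃ n : ℕ, ringKrullDim R = n ∧ (∀ e, hkLength p R e ≠ ⊤) ∧
    Tendsto (fun e : ℕ => ((hkLength p R e).toNat : ℝ) / (p : ℝ) ^ (e * n)) atTop (𝓝 c)

theorem HasHKMultiplicity.unique {p : ℕ} {R : Type*} [CommRing R] [IsLocalRing R] [CharP R p]
    {c c' : ℝ} (h : HasHKMultiplicity p R c) (h' : HasHKMultiplicity p R c') : c = c' := by
  obtain ⟨n, hn, -, ht⟩ := h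
  obtain ⟨n', hn', -, ht'⟩ := h'
  have : n = n' := by
    rw [hn] at hn'
    exact_mod_cast hn'
  subst this
  exact tendsto_nhds_unique ht ht'

open Classical in
/-- The Hilbert-Kunz multiplicity `lim_e λ(R / m^[p^e]) / p^(e dim R)`
(with the value `0` if the limit does not exist). -/
noncomputable def eHK (p : ℕ) (R : Type*) [CommRing R] [IsLocalRing R] [CharP R p] : ℝ :=
  if h : ∃ c, HasHKMultiplicity p R c then h.choose else 0

theorem HasHKMultiplicity.eHK_eq {p : ℕ} {R : Type*} [CommRing R] [IsLocalRing R] [CharP R p]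
    {c : ℝ} (h : HasHKMultiplicity p R c) : eHK p R = c := by
  have h' : ∃ c, HasHKMultiplicity p R c := ⟨c, h⟩
  rw [eHK, dif_pos h']
  exact h'.choose_spec.unique h

/-- The power series `x_0 ^ 2 + ⋯ + x_d ^ 2` in `k[[x_0, …, x_d]]`. -/
noncomputable def quadricEq (k : Type*) [Field k] (d : ℕ) : MvPowerSeries (Fin (d + 1)) k :=
  ∑ i, MvPowerSeries.X i ^ 2

/-- The ring `k[[x_0, …, x_d]] / (x_0 ^ 2 + ⋯ + x_d ^ 2)`. -/
abbrev Quadric (k : Type*) [Field k] (d : ℕ) : Type _ :=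
  MvPowerSeries (Fin (d + 1)) k ⧸ Ideal.span {quadricEq k d}

instance (k : Type*) [Field k] (d : ℕ) : Nontrivial (Quadric k d) := by
  refine Ideal.Quotient.nontrivial_iff.mpr fun h => ?_
  rw [Ideal.span_singleton_eq_top, MvPowerSeries.isUnit_iff_constantCoeff] at h
  simp [quadricEq] at h

instance (k : Type*) [Field k] (d : ℕ) : IsLocalRing (Quadric k d) :=
  IsLocalRing.of_surjective' (Ideal.Quotient.mk _) Ideal.Quotient.mk_surjective

instance (k : Type*) [Field k] (p : ℕ) [CharP k p] (d : ℕ) : CharP (Quadric k d) p :=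
  charP_of_injective_algebraMap (algebraMap k (Quadric k d)).injective p

/-- The simple `(A_1)`-singularity `A_{p,d} = 𝔽_p[[x_0, …, x_d]] / (x_0 ^ 2 + ⋯ + x_d ^ 2)`. -/
abbrev A (p d : ℕ) [Fact p.Prime] : Type := Quadric (ZMod p) d

/-- The matrix `T_a`: with rows and columns numbered `0, …, 2a`, the entries are `2` in the
top-left triangle `i + j < a` and in the bottom-right triangle `i + j > 3a`, `0` in the other two
corner triangles `|i - j| > a`, and `1` in the remaining central diamond. -/
def T (a : ℕ) : Matrix (Fin (2 * a + 1)) (Fin (2 * a + 1)) ℤ :=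
  Matrix.of fun i j =>
    if (i : ℕ) + j < a ∨ 3 * a < (i : ℕ) + j then 2
    else if (i : ℕ) + a < j ∨ (j : ℕ) + a < i then 0
    else 1

/-- The matrix `N_a`: the same central diamond of ones as in `T_a`, and `0` in all four corner
triangles. -/
def N (a : ℕ) : Matrix (Fin (2 * a + 1)) (Fin (2 * a + 1)) ℤ :=
  Matrix.of fun i j =>
    if (i : ℕ) + j < a ∨ 3 * a < (i : ℕ) + j then 0
    else if (i : ℕ) + a < j ∨ (j : ℕ) + a < i then 0
    else 1

end HilbertKunz

/-! The length of R / m^[q], for q = p^e, is the k-dimension of k[x_i]/(x_i^q, ∑ x_i^2). Following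
the idea of a representation ring, let δ_m (`jordan`) be the class of k[x]/(x^m) with multiplication
by x. Products stand for tensor products with the sum of the operators, and `trace` counts Jordan
blocks, that is, the dimension of the cokernel. The length is then the trace of S_q^(d+1), where S_q
= `slot k (q, 2)` is the class of x^2 on k[x]/(x^q).

Write q = 2b+1, p = 2a+1, D_i = δ_(qi+1) - δ_(qi) and R = δ_b + δ_(b+1) - δ_q. Since S_q = δ_b +
δ_(b+1), one gets S_q = R + δ_q with R δ_q = 0, and S_(pq) = I + D_a R with I = δ_(qa) + δ_(q(a+1))
and I R = 0. Powers of both sums therefore split.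

The matrices enter through the products with δ_(q+1). On the vector (D_i R)_i the element D_1 - 1
acts as the path matrix with end loops -1, and on (δ_(q(i+1)) - δ_(qi))_i the element D_1 + 1 acts
as the path matrix with end loops 1. A vector on which a path matrix acts as a scalar is determined
by its first entry, so D_a and I act as any matrix that commutes with the path matrix and has the
right first row: these are N and qT (`pow_smul_eq_mulVec`). Taking traces gives
`trace_slot_pow_succ`, L_(e+1) = q^d T' + N' (L_e - q^d), where T' and N' are the corner entries of
T^(d+1) and N^(d+1). As 0 ≤ N' < p^d, its solution divided by p^(ed) converges to the stated value,
which does not involve k.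

The multiplication rules come from diagonalising (τ + y)^i over A in A[y]/(y^j)
(`finrank_quotient_eq_sum`), using Frobenius. -/

namespace HilbertKunz

/-! ### Truncated polynomial algebras and the separation of one variable. -/

section Box

open Polynomial in
/-- For a nilpotent variable `y` with `y ^ m = 0`, setting `τ + y = 0` amounts to `τ ^ m = 0`. -/
noncomputable def adjoinRootQuotientEquiv (k : Type*) [Field k] {R : Type*} [CommRing R]
    [Algebra k R] (τ : R) (m : ℕ) :
    (AdjoinRoot (X ^ m : R[X]) ⧸ Ideal.span
      {AdjoinRoot.of (X ^ m : R[X]) τ + AdjoinRoot.root (X ^ m : R[X])}) ≃ₐ[k]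
      (R ⧸ Ideal.span {τ ^ m}) := by
  have hroot : (AdjoinRoot.root (X ^ m : R[X])) ^ m = 0 := by
    simpa using AdjoinRoot.eval₂_root (X ^ m : R[X])
  have heval : (X ^ m : R[X]).eval₂ (Ideal.Quotient.mkₐ k (Ideal.span {τ ^ m})).toRingHom
      (-(Ideal.Quotient.mk _ τ)) = 0 := by
    rw [eval₂_X_pow, neg_pow, ← map_pow,
      Ideal.Quotient.eq_zero_iff_mem.mpr (Ideal.mem_span_singleton_self _), mul_zero]
  refine AlgEquiv.ofAlgHom
    (Ideal.Quotient.liftₐ _ (AdjoinRoot.liftAlgHom (X ^ m : R[X])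
      (Ideal.Quotient.mkₐ k (Ideal.span {τ ^ m})) (-(Ideal.Quotient.mk _ τ)) heval) ?_)
    (Ideal.Quotient.liftₐ _ ((Ideal.Quotient.mkₐ k _).comp
      (IsScalarTower.toAlgHom k R (AdjoinRoot (X ^ m : R[X])))) ?_) ?_ ?_
  · intro a ha
    obtain ⟨c, rfl⟩ := Ideal.mem_span_singleton'.mp ha
    rw [map_mul, map_add]
    change _ * (AdjoinRoot.lift _ _ heval _ + AdjoinRoot.lift _ _ heval _) = 0
    rw [AdjoinRoot.lift_of, AdjoinRoot.lift_root]
    exact mul_eq_zero_of_right _ (add_neg_cancel _)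
  · intro a ha
    obtain ⟨c, rfl⟩ := Ideal.mem_span_singleton'.mp ha
    have h : (Ideal.Quotient.mk (Ideal.span {AdjoinRoot.of (X ^ m : R[X]) τ + AdjoinRoot.root _}))
        (AdjoinRoot.of (X ^ m : R[X]) τ) = - Ideal.Quotient.mk _ (AdjoinRoot.root _) := by
      rw [eq_neg_iff_add_eq_zero, ← map_add]
      exact Ideal.Quotient.eq_zero_iff_mem.mpr (Ideal.mem_span_singleton_self _)
    simp only [AlgHom.comp_apply, IsScalarTower.coe_toAlgHom', AdjoinRoot.algebraMap_eq,
      Ideal.Quotient.mkₐ_eq_mk, map_mul, map_pow, h]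
    rw [neg_pow, ← map_pow, hroot]
    simp
  · apply Ideal.Quotient.algHom_ext
    ext x
    exact AdjoinRoot.lift_of heval
  · apply Ideal.Quotient.algHom_ext
    apply AdjoinRoot.algHom_ext'
    · ext x
      exact congrArg _ (AdjoinRoot.lift_of heval)
    · refine (congrArg _ (AdjoinRoot.lift_root heval)).trans ((map_neg _ _).trans ?_)
      change - Ideal.Quotient.mk _ (AdjoinRoot.of _ τ) = Ideal.Quotient.mk _ (AdjoinRoot.root _)
      rw [neg_eq_iff_add_eq_zero, ← map_add]
      exact Ideal.Quotient.eq_zero_iff_mem.mpr (Ideal.mem_span_singleton_self _)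

open MvPolynomial

variable (k : Type*) [Field k] {σ : Type*}

/-- The ideal generated by the powers `x_i ^ m_i`, where `v i = (m_i, c_i)`. -/
noncomputable def boxIdeal (v : σ → ℕ × ℕ) : Ideal (MvPolynomial σ k) :=
  Ideal.span (Set.range fun i => (X i : MvPolynomial σ k) ^ (v i).1)

/-- The truncated polynomial ring `k[x_i] / (x_i ^ m_i)`, where `v i = (m_i, c_i)`. -/
abbrev Box (v : σ → ℕ × ℕ) : Type _ := MvPolynomial σ k ⧸ boxIdeal k v

/-- The class of the variable `x_i`. -/
noncomputable def boxVar (v : σ → ℕ × ℕ) (i : σ) : Box k v := Ideal.Quotient.mk _ (X i)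

/-- The element `∑ x_i ^ c_i`, where `v i = (m_i, c_i)`. -/
noncomputable def boxSum [Fintype σ] (v : σ → ℕ × ℕ) : Box k v := ∑ i, boxVar k v i ^ (v i).2

/-- The dimension of `k[x_i] / (x_i ^ m_i, ∑ x_i ^ c_i)`, where `v i = (m_i, c_i)`. -/
noncomputable def boxDim [Fintype σ] (v : σ → ℕ × ℕ) : ℕ :=
  Module.finrank k (Box k v ⧸ Ideal.span {boxSum k v})

theorem boxVar_pow (v : σ → ℕ × ℕ) (i : σ) : boxVar k v i ^ (v i).1 = 0 := by
  rw [boxVar, ← map_pow]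
  exact Ideal.Quotient.eq_zero_iff_mem.mpr (Ideal.subset_span ⟨i, rfl⟩)

variable {k}

/-- Homomorphisms out of a truncated polynomial ring. -/
noncomputable def boxLift (v : σ → ℕ × ℕ) {B : Type*} [CommRing B] [Algebra k B] (x : σ → B)
    (h : ∀ i, x i ^ (v i).1 = 0) : Box k v →ₐ[k] B :=
  Ideal.Quotient.liftₐ _ (aeval x) fun a ha => by
    have : boxIdeal k v ≤ RingHom.ker (aeval x : MvPolynomial σ k →ₐ[k] B) := by
      rw [boxIdeal, Ideal.span_le]
      rintro _ ⟨i, rfl⟩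
      simp [h]
    exact this ha

@[simp]
theorem boxLift_boxVar (v : σ → ℕ × ℕ) {B : Type*} [CommRing B] [Algebra k B] (x : σ → B)
    (h : ∀ i, x i ^ (v i).1 = 0) (i : σ) : boxLift v x h (boxVar k v i) = x i := by
  exact aeval_X x i

theorem box_hom_ext {v : σ → ℕ × ℕ} {B : Type*} [CommRing B] [Algebra k B]
    {f g : Box k v →ₐ[k] B} (h : ∀ i, f (boxVar k v i) = g (boxVar k v i)) : f = g := by
  apply Ideal.Quotient.algHom_ext
  apply MvPolynomial.algHom_ext
  exact h

theorem box_adjoin_range (v : σ → ℕ × ℕ) : Algebra.adjoin k (Set.range (boxVar k v)) = ⊤ := by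
  have : Set.range (boxVar k v) = Ideal.Quotient.mkₐ k (boxIdeal k v) '' Set.range X := by
    rw [← Set.range_comp]; rfl
  rw [this, ← AlgHom.map_adjoin, MvPolynomial.adjoin_range_X, Algebra.map_top,
    AlgHom.range_eq_top]
  exact Ideal.Quotient.mkₐ_surjective k _

theorem box_finite [Finite σ] (v : σ → ℕ × ℕ) : Module.Finite k (Box k v) := by
  have h := box_adjoin_range (k := k) v
  have hint : ∀ x ∈ Set.range (boxVar k v), IsIntegral k x := by
    rintro _ ⟨i, rfl⟩
    exact ⟨Polynomial.X ^ (v i).1, Polynomial.monic_X_pow _, by simp [boxVar_pow]⟩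
  have hfg : (Algebra.adjoin k (Set.range (boxVar k v))).toSubmodule.FG :=
    fg_adjoin_of_finite (Set.finite_range _) hint
  rw [h, Algebra.top_toSubmodule] at hfg
  exact ⟨hfg⟩

/-- Reindexing the variables. -/
noncomputable def boxCongr {σ' : Type*} (e : σ ≃ σ') (v : σ → ℕ × ℕ) (v' : σ' → ℕ × ℕ)
    (h : ∀ i, v' (e i) = v i) : Box k v ≃ₐ[k] Box k v' :=
  AlgEquiv.ofAlgHom (boxLift v (fun i => boxVar k v' (e i)) fun i => h i ▸ boxVar_pow k v' (e i))
    (boxLift v' (fun i => boxVar k v (e.symm i)) fun i => by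
      have := h (e.symm i)
      rw [e.apply_symm_apply] at this
      exact this ▸ boxVar_pow k v (e.symm i))
    (box_hom_ext fun i => by simp) (box_hom_ext fun i => by simp)

theorem boxCongr_boxSum {σ' : Type*} [Fintype σ] [Fintype σ'] (e : σ ≃ σ') (v : σ → ℕ × ℕ)
    (v' : σ' → ℕ × ℕ) (h : ∀ i, v' (e i) = v i) :
    boxCongr e v v' h (boxSum k v) = boxSum k v' := by
  simp only [boxSum, boxCongr, map_sum, map_pow, AlgEquiv.ofAlgHom_apply, boxLift_boxVar]
  exact Fintype.sum_equiv e _ _ fun i => by rw [h]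

theorem boxDim_pow_congr {σ' : Type*} [Fintype σ] [Fintype σ'] (e : σ ≃ σ') (v : σ → ℕ × ℕ)
    (v' : σ' → ℕ × ℕ) (h : ∀ i, v' (e i) = v i) (n : ℕ) :
    Module.finrank k (Box k v ⧸ Ideal.span {boxSum k v ^ n}) =
      Module.finrank k (Box k v' ⧸ Ideal.span {boxSum k v' ^ n}) := by
  refine (Ideal.quotientEquivAlg _ _ (boxCongr e v v' h) ?_).toLinearEquiv.finrank_eq
  rw [Ideal.map_span, Set.image_singleton]
  congr 2
  have := boxCongr_boxSum (k := k) e v v' h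
  simp only [← this, map_pow]
  rfl

theorem boxDim_congr {σ' : Type*} [Fintype σ] [Fintype σ'] (e : σ ≃ σ') (v : σ → ℕ × ℕ)
    (v' : σ' → ℕ × ℕ) (h : ∀ i, v' (e i) = v i) : boxDim k v = boxDim k v' := by
  have := boxDim_pow_congr (k := k) e v v' h 1
  rwa [pow_one, pow_one] at this

/-- Separating one variable. -/
noncomputable def boxOption (v : Option σ → ℕ × ℕ) : Box k v ≃ₐ[k]
    AdjoinRoot (Polynomial.X ^ (v none).1 : Polynomial (Box k fun i => v (some i))) := by
  have hroot : (AdjoinRoot.root (Polynomial.X ^ (v none).1 :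
      Polynomial (Box k fun i => v (some i)))) ^ (v none).1 = 0 := by
    simpa using AdjoinRoot.eval₂_root (Polynomial.X ^ (v none).1 :
      Polynomial (Box k fun i => v (some i)))
  refine AlgEquiv.ofAlgHom
    (boxLift v (fun i => i.elim (AdjoinRoot.root _)
      fun j => AdjoinRoot.of _ (boxVar k (fun i => v (some i)) j)) ?_)
    (AdjoinRoot.liftAlgHom _ (boxLift (fun i => v (some i)) (fun j => boxVar k v (some j))
      fun j => boxVar_pow k v (some j)) (boxVar k v none) ?_) ?_ ?_
  · rintro (_ | j)
    · exact hroot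
    · simp only [Option.elim_some]
      rw [← map_pow, boxVar_pow k (fun i => v (some i)) j, map_zero]
  · simp [boxVar_pow]
  · apply AdjoinRoot.algHom_ext'
    · refine box_hom_ext fun j => ?_
      simp [AdjoinRoot.ofAlgHom]
    · simp
  · refine box_hom_ext fun i => ?_
    cases i <;> simp

theorem boxOption_boxSum [Fintype σ] (v : Option σ → ℕ × ℕ) :
    boxOption v (boxSum k v) =
      AdjoinRoot.of _ (boxSum k fun i => v (some i)) + AdjoinRoot.root _ ^ (v none).2 := by
  simp only [boxSum, boxOption, map_sum, map_pow, AlgEquiv.ofAlgHom_apply, boxLift_boxVar,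
    Fintype.sum_option, map_add, Option.elim_none, Option.elim_some]
  rw [add_comm]

theorem finrank_boxOption [Fintype σ] (v : Option σ → ℕ × ℕ) (n : ℕ) :
    Module.finrank k (Box k v ⧸ Ideal.span {boxSum k v ^ n}) =
      Module.finrank k (AdjoinRoot (Polynomial.X ^ (v none).1 :
        Polynomial (Box k fun i => v (some i))) ⧸ Ideal.span {(AdjoinRoot.of _
        (boxSum k fun i => v (some i)) + AdjoinRoot.root _ ^ (v none).2) ^ n}) := by
  refine (Ideal.quotientEquivAlg _ _ (boxOption v) ?_).toLinearEquiv.finrank_eq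
  rw [Ideal.map_span, Set.image_singleton]
  congr 2
  rw [← boxOption_boxSum (k := k) v, ← map_pow]
  rfl

/-- A variable y entering the sum linearly can be eliminated as y = -τ; its truncation y^m = 0 then
becomes τ^m = 0. -/
theorem boxDim_option [Fintype σ] (v : Option σ → ℕ × ℕ) (m : ℕ) (h : v none = (m, 1)) :
    boxDim k v = Module.finrank k ((Box k fun i => v (some i)) ⧸
      Ideal.span {(boxSum k fun i => v (some i)) ^ m}) := by
  have := finrank_boxOption (k := k) v 1
  rw [pow_one] at this
  rw [boxDim, this, h, pow_one, pow_one]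
  exact (adjoinRootQuotientEquiv k _ m).toLinearEquiv.finrank_eq

end Box

end HilbertKunz

namespace HilbertKunz

/-! ### A representation ring defined by its trace form. -/

section Ring

open MvPolynomial

variable (k : Type*) [Field k]

/-- The dimension of `k[x_i] / (x_i ^ m_i, ∑ x_i ^ c_i)` for a multiset of pairs `(m_i, c_i)`. -/
noncomputable def slotDim (s : Multiset (ℕ × ℕ)) : ℕ := boxDim k fun x : s => x.1

theorem consEquiv_elim (a : ℕ × ℕ) (s : Multiset (ℕ × ℕ)) (x : (a ::ₘ s : Multiset (ℕ × ℕ))) :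
    (Multiset.consEquiv x).elim a (fun y => y.1) = x.1 := by
  obtain ⟨y, rfl⟩ := Multiset.consEquiv.symm.surjective x
  rw [Equiv.apply_symm_apply]
  cases y <;> rfl

theorem slotDim_cons (m : ℕ) (s : Multiset (ℕ × ℕ)) :
    slotDim k ((m, 1) ::ₘ s) = Module.finrank k ((Box k fun x : s => x.1) ⧸
      Ideal.span {(boxSum k fun x : s => x.1) ^ m}) := by
  rw [slotDim, boxDim_congr (k := k) Multiset.consEquiv _
    (fun y => y.elim (m, 1) fun y => y.1) (consEquiv_elim (m, 1) s)]
  exact boxDim_option _ m rfl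

theorem finrank_slot_cons (a : ℕ × ℕ) (n : ℕ) (s : Multiset (ℕ × ℕ)) :
    Module.finrank k ((Box k fun x : (a ::ₘ s : Multiset (ℕ × ℕ)) => x.1) ⧸
      Ideal.span {(boxSum k fun x : (a ::ₘ s : Multiset (ℕ × ℕ)) => x.1) ^ n}) =
    Module.finrank k (AdjoinRoot (Polynomial.X ^ a.1 : Polynomial (Box k fun x : s => x.1)) ⧸
      Ideal.span {(AdjoinRoot.of _ (boxSum k fun x : s => x.1) + AdjoinRoot.root _ ^ a.2) ^ n}) := by
  rw [boxDim_pow_congr (k := k) Multiset.consEquiv _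
    (fun y => y.elim a fun y => y.1) (consEquiv_elim a s) n]
  exact finrank_boxOption (fun y : Option s => y.elim a fun y => y.1) n

/-- Of two linear variables only the first is eliminated. What remains is a computation in a free
algebra of rank j over the algebra of the other variables, the setting of all product rules. -/
theorem slotDim_cons_cons (i j : ℕ) (s : Multiset (ℕ × ℕ)) :
    slotDim k ((i, 1) ::ₘ (j, 1) ::ₘ s) = Module.finrank k
      (AdjoinRoot (Polynomial.X ^ j : Polynomial (Box k fun x : s => x.1)) ⧸
      Ideal.span {(AdjoinRoot.of _ (boxSum k fun x : s => x.1) + AdjoinRoot.root _) ^ i}) := by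
  rw [slotDim_cons, finrank_slot_cons, pow_one]

theorem slotDim_cons' (a : ℕ × ℕ) (s : Multiset (ℕ × ℕ)) :
    slotDim k (a ::ₘ s) = Module.finrank k
      (AdjoinRoot (Polynomial.X ^ a.1 : Polynomial (Box k fun x : s => x.1)) ⧸
      Ideal.span {AdjoinRoot.of _ (boxSum k fun x : s => x.1) + AdjoinRoot.root _ ^ a.2}) := by
  have := finrank_slot_cons k a 1 s
  rw [pow_one, pow_one] at this
  exact this

/-- The linear extension of `slotDim` to the polynomial ring on the pairs `(m, c)`. -/
noncomputable def slotTrace : MvPolynomial (ℕ × ℕ) ℤ →ₗ[ℤ] ℤ :=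
  (basisMonomials (ℕ × ℕ) ℤ).constr ℤ fun s => (slotDim k (Finsupp.toMultiset s) : ℤ)

theorem prod_map_X (s : Multiset (ℕ × ℕ)) :
    (s.map (X : ℕ × ℕ → MvPolynomial (ℕ × ℕ) ℤ)).prod = monomial (Multiset.toFinsupp s) 1 := by
  induction s using Multiset.induction with
  | empty => simp
  | cons a s ih =>
    rw [Multiset.map_cons, Multiset.prod_cons, ih, X, monomial_mul, one_mul,
      ← Multiset.singleton_add, map_add, Multiset.toFinsupp_singleton]

theorem slotTrace_prod (s : Multiset (ℕ × ℕ)) :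
    slotTrace k (s.map X).prod = slotDim k s := by
  have : (monomial (Multiset.toFinsupp s) 1 : MvPolynomial (ℕ × ℕ) ℤ) =
      basisMonomials (ℕ × ℕ) ℤ (Multiset.toFinsupp s) := rfl
  rw [prod_map_X, slotTrace, this, Module.Basis.constr_basis, Multiset.toFinsupp_toMultiset]

/-- The radical of the trace form. -/
noncomputable def slotRadical : Ideal (MvPolynomial (ℕ × ℕ) ℤ) where
  carrier := {x | ∀ y, slotTrace k (x * y) = 0}
  add_mem' hx hy z := by rw [add_mul, map_add, hx, hy, add_zero]
  zero_mem' y := by rw [zero_mul, map_zero]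
  smul_mem' c x hx y := by rw [smul_eq_mul, mul_comm c, mul_assoc, hx]

/-- A ring in which `(m, c)` stands for `k[x] / (x ^ m)` with the operator `x ^ c`, products stand
for tensor products, and elements with the same trace form are identified. -/
abbrev SlotRing : Type := MvPolynomial (ℕ × ℕ) ℤ ⧸ slotRadical k

/-- The class of `k[x] / (x ^ m)` with the operator `x ^ c`. -/
noncomputable def slot (a : ℕ × ℕ) : SlotRing k := Ideal.Quotient.mk _ (X a)

/-- The class of `k[x] / (x ^ m)` with the operator `x`. -/
noncomputable def jordan (m : ℕ) : SlotRing k := slot k (m, 1)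

/-- The number of Jordan blocks. -/
noncomputable def trace : SlotRing k →+ ℤ :=
  QuotientAddGroup.lift (slotRadical k).toAddSubgroup (slotTrace k).toAddMonoidHom fun x hx => by
    have : slotTrace k (x * 1) = 0 := hx 1
    rwa [mul_one] at this

theorem trace_mk (x : MvPolynomial (ℕ × ℕ) ℤ) :
    trace k (Ideal.Quotient.mk _ x) = slotTrace k x := rfl

theorem prod_map_slot (s : Multiset (ℕ × ℕ)) :
    (s.map (slot k)).prod = Ideal.Quotient.mk (slotRadical k) (s.map X).prod := by
  rw [map_multiset_prod, Multiset.map_map]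
  rfl

theorem trace_prod (s : Multiset (ℕ × ℕ)) : trace k (s.map (slot k)).prod = slotDim k s := by
  rw [← slotTrace_prod, ← trace_mk, prod_map_slot]

/-- Dividing by the radical makes the trace form nondegenerate, and monomials in the generators
span. Each identity in the ring thus reduces to a dimension count with arbitrary further variables.
-/
theorem slotRing_ext {x y : SlotRing k}
    (h : ∀ s : Multiset (ℕ × ℕ), trace k (x * (s.map (slot k)).prod) =
      trace k (y * (s.map (slot k)).prod)) : x = y := by
  obtain ⟨x, rfl⟩ := Ideal.Quotient.mk_surjective x
  obtain ⟨y, rfl⟩ := Ideal.Quotient.mk_surjective y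
  rw [Ideal.Quotient.eq]
  have : (slotTrace k).comp (LinearMap.mulLeft ℤ (x - y)) = 0 := by
    refine (basisMonomials (ℕ × ℕ) ℤ).ext fun s => ?_
    have := h (Finsupp.toMultiset s)
    rw [prod_map_slot, prod_map_X, Finsupp.toMultiset_toFinsupp, ← map_mul, ← map_mul, trace_mk,
      trace_mk] at this
    simp [sub_mul, this]
  exact fun z => LinearMap.congr_fun this z

theorem trace_jordan_mul (m : ℕ) (s : Multiset (ℕ × ℕ)) :
    trace k (jordan k m * (s.map (slot k)).prod) = Module.finrank k ((Box k fun x : s => x.1) ⧸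
      Ideal.span {(boxSum k fun x : s => x.1) ^ m}) := by
  rw [← slotDim_cons, ← trace_prod, Multiset.map_cons, Multiset.prod_cons, jordan]

theorem trace_jordan_mul_jordan_mul (i j : ℕ) (s : Multiset (ℕ × ℕ)) :
    trace k (jordan k i * jordan k j * (s.map (slot k)).prod) = Module.finrank k
      (AdjoinRoot (Polynomial.X ^ j : Polynomial (Box k fun x : s => x.1)) ⧸
      Ideal.span {(AdjoinRoot.of _ (boxSum k fun x : s => x.1) + AdjoinRoot.root _) ^ i}) := by
  rw [← slotDim_cons_cons, ← trace_prod, Multiset.map_cons, Multiset.prod_cons, Multiset.map_cons,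
    Multiset.prod_cons, jordan, jordan, mul_assoc]

theorem trace_slot_mul (a : ℕ × ℕ) (s : Multiset (ℕ × ℕ)) :
    trace k (slot k a * (s.map (slot k)).prod) = Module.finrank k
      (AdjoinRoot (Polynomial.X ^ a.1 : Polynomial (Box k fun x : s => x.1)) ⧸
      Ideal.span {AdjoinRoot.of _ (boxSum k fun x : s => x.1) + AdjoinRoot.root _ ^ a.2}) := by
  rw [← slotDim_cons', ← trace_prod, Multiset.map_cons, Multiset.prod_cons]

theorem jordan_zero : jordan k 0 = 0 := by
  refine slotRing_ext k fun s => ?_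
  rw [trace_jordan_mul, pow_zero, Ideal.span_singleton_one, zero_mul, map_zero]
  have : Subsingleton ((Box k fun x : s => x.1) ⧸ (⊤ : Ideal (Box k fun x : s => x.1))) :=
    Ideal.Quotient.subsingleton_iff.mpr rfl
  exact_mod_cast Module.finrank_zero_of_subsingleton

end Ring

end HilbertKunz

namespace HilbertKunz

/-! ### Dimensions of quotients in diagonal form. -/

section Diagonal

variable {k A : Type*} [Field k] [CommRing A] [Algebra k A]

/-- The dimension of the quotient of a free module by a submodule in diagonal form. -/
theorem finrank_quotient_of_diagonal [Module.Finite k A] {E : Type*} [AddCommGroup E]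
    [Module A E] [Module k E] [IsScalarTower k A E] {ι : Type*} [Fintype ι]
    (b : Module.Basis ι A E) (b' : ι → E) (hb : ∀ i, b i ∈ Submodule.span A (Set.range b'))
    (t : ι → A) (N : Submodule A E) (hN : N = Submodule.span A (Set.range fun i => t i • b' i)) :
    Module.finrank k (E ⧸ N) = ∑ i, Module.finrank k (A ⧸ Ideal.span {t i}) := by
  classical
  let f : (ι → A) →ₗ[A] E := Fintype.linearCombination A b'
  have hf : Function.Surjective f := by
    rw [← LinearMap.range_eq_top, Fintype.range_linearCombination, eq_top_iff, ← b.span_eq,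
      Submodule.span_le]
    rintro _ ⟨i, rfl⟩
    exact hb i
  have hg : Function.Injective (b.equivFun.toLinearMap ∘ₗ f) :=
    OrzechProperty.injective_of_surjective_endomorphism _ (b.equivFun.surjective.comp hf)
  have hfi : Function.Injective f := fun x y hxy => hg (by simp [hxy])
  let e : (ι → A) ≃ₗ[A] E := LinearEquiv.ofBijective f ⟨hfi, hf⟩
  have he : ∀ i, e (Pi.single i 1) = b' i := fun i => by
    change Fintype.linearCombination A b' (Pi.single i 1) = b' i
    rw [Fintype.linearCombination_apply_single, one_smul]
  have hmap : (Submodule.pi Set.univ fun i => Ideal.span {t i}).map e.toLinearMap = N := by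
    rw [hN]
    apply le_antisymm
    · rintro _ ⟨x, hx, rfl⟩
      change e x ∈ _
      rw [pi_eq_sum_univ' x, map_sum]
      refine Submodule.sum_mem _ fun i _ => ?_
      obtain ⟨c, hc⟩ := Ideal.mem_span_singleton'.mp (hx i trivial)
      rw [map_smul, he, ← hc, mul_smul]
      exact Submodule.smul_mem _ _ (Submodule.subset_span ⟨i, rfl⟩)
    · rw [Submodule.span_le]
      rintro _ ⟨i, rfl⟩
      refine ⟨t i • Pi.single i 1, fun j _ => ?_, (map_smul e _ _).trans (by rw [he])⟩
      by_cases hij : j = i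
      · subst hij; simp
      · simp [hij]
  let e' : ((ι → A) ⧸ Submodule.pi Set.univ fun i => Ideal.span {t i}) ≃ₗ[A] E ⧸ N :=
    Submodule.Quotient.equiv _ _ e hmap
  let e'' := (Submodule.quotientPi fun i => Ideal.span {t i}).restrictScalars k
  rw [← (e'.restrictScalars k).finrank_eq, e''.finrank_eq]
  exact Module.finrank_pi_fintype k

/-- The dimension of `A / (τ ^ n)`. -/
noncomputable def finrankModPow (k : Type*) {A : Type*} [Field k] [CommRing A] [Algebra k A]
    (τ : A) (n : ℕ) : ℕ :=
  Module.finrank k (A ⧸ Ideal.span {τ ^ n})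

theorem finrankModPow_zero (k : Type*) {A : Type*} [Field k] [CommRing A] [Algebra k A] (τ : A) :
    finrankModPow k τ 0 = 0 := by
  rw [finrankModPow, pow_zero, Ideal.span_singleton_one]
  have : Subsingleton (A ⧸ (⊤ : Ideal A)) := Ideal.Quotient.subsingleton_iff.mpr rfl
  exact Module.finrank_zero_of_subsingleton

variable {B : Type*} [CommRing B] [Algebra A B] [Algebra k B] [IsScalarTower k A B]

/-- The dimension of the quotient of a free algebra by a principal ideal in diagonal form. -/
theorem finrank_quotient_eq_sum [Module.Finite k A] {j : ℕ} (b : Module.Basis (Fin j) A B)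
    (τ : A) (β : ℕ → B) (ex : ℕ → ℕ) (c : ℕ → B) (h : B)
    (hc : ∀ i : Fin j, b i ∈ Submodule.span A (c '' Set.Iio j))
    (hβ : ∀ i < j, c i ∈ Submodule.span A (β '' Set.Iio j))
    (hle : ∀ i < j, algebraMap A B τ ^ ex i * β i ∈ Ideal.span {h})
    (hge : ∀ i < j, h * c i ∈
      Submodule.span A ((fun i => algebraMap A B τ ^ ex i * β i) '' Set.Iio j)) :
    Module.finrank k (B ⧸ Ideal.span {h}) =
      ∑ i ∈ Finset.range j, finrankModPow k τ (ex i) := by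
  have himg : ∀ f : ℕ → B, f '' Set.Iio j = Set.range fun i : Fin j => f i := fun f => by
    ext x
    constructor
    · rintro ⟨i, hi, rfl⟩; exact ⟨⟨i, hi⟩, rfl⟩
    · rintro ⟨i, rfl⟩; exact ⟨i, i.2, rfl⟩
  have hcβ : Submodule.span A (c '' Set.Iio j) ≤ Submodule.span A (β '' Set.Iio j) := by
    rw [Submodule.span_le]
    rintro _ ⟨i, hi, rfl⟩
    exact hβ i hi
  have hctop : Submodule.span A (c '' Set.Iio j) = ⊤ := by
    rw [eq_top_iff, ← b.span_eq, Submodule.span_le]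
    rintro _ ⟨i, rfl⟩
    exact hc i
  have key := finrank_quotient_of_diagonal (k := k) b (fun i => β i)
    (fun i => himg β ▸ hcβ (hc i)) (fun i => τ ^ ex i)
    ((Ideal.span {h} : Ideal B).restrictScalars A) (by
      have : (fun i : Fin j => τ ^ ex i • β i) =
          fun i : Fin j => (fun i => algebraMap A B τ ^ ex i * β i) (i : ℕ) := by
        ext i; simp [Algebra.smul_def]
      rw [this, ← himg fun i => algebraMap A B τ ^ ex i * β i]
      apply le_antisymm
      -- As `c` spans B over A, the ideal (h) is the A-span of the products h c_i.
      · intro x hx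
        obtain ⟨y, rfl⟩ := Ideal.mem_span_singleton'.mp hx
        rw [mul_comm]
        have hy : y ∈ Submodule.span A (c '' Set.Iio j) := hctop ▸ Submodule.mem_top
        induction hy using Submodule.span_induction with
        | mem z hz => obtain ⟨i, hi, rfl⟩ := hz; exact hge i hi
        | zero => rw [mul_zero]; exact Submodule.zero_mem _
        | add z w _ _ hz hw =>
          rw [mul_add]
          exact Submodule.add_mem _ (hz (Ideal.mul_mem_left _ _ (Ideal.mem_span_singleton_self h)))
            (hw (Ideal.mul_mem_left _ _ (Ideal.mem_span_singleton_self h)))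
        | smul a z _ hz =>
          rw [mul_smul_comm]
          exact Submodule.smul_mem _ _
            (hz (Ideal.mul_mem_left _ _ (Ideal.mem_span_singleton_self h)))
      · rw [Submodule.span_le]
        rintro _ ⟨i, hi, rfl⟩
        exact hle i hi)
  rw [Finset.sum_range]
  refine Eq.trans ?_ key
  exact ((Submodule.Quotient.restrictScalarsEquiv A (Ideal.span {h} : Ideal B)).restrictScalars
    k).symm.finrank_eq

theorem add_pow_prime_pow (k : Type*) [Field k] (p : ℕ) [Fact p.Prime] [CharP k p] {B : Type*}
    [CommRing B] [Algebra k B] (e : ℕ) (x y : B) :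
    (x + y) ^ p ^ e = x ^ p ^ e + y ^ p ^ e := by
  nontriviality B
  have := charP_of_injective_algebraMap (algebraMap k B).injective p
  exact add_pow_char_pow x y p e

theorem mem_of_natCast_mul_mem {n : ℕ} (hn : (n : k) ≠ 0) {S : Submodule A B} {v : B}
    (h : (n : B) * v ∈ S) : v ∈ S := by
  have : v = algebraMap k A (n : k)⁻¹ • ((n : B) * v) := by
    rw [Algebra.smul_def, ← IsScalarTower.algebraMap_apply k A B, ← map_natCast (algebraMap k B) n,
      ← mul_assoc, ← map_mul, inv_mul_cancel₀ hn, map_one, one_mul]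
  rw [this]
  exact S.smul_mem _ h

theorem algebraMap_pow_mul_mem {S : Submodule A B} {v : B} (τ : A) (n : ℕ) (h : v ∈ S) :
    algebraMap A B τ ^ n * v ∈ S := by
  rw [← map_pow, ← Algebra.smul_def]
  exact S.smul_mem _ h

theorem natCast_mul_mem {S : Submodule A B} {v : B} (n : ℕ) (h : v ∈ S) : (n : B) * v ∈ S := by
  rw [← nsmul_eq_mul]
  exact S.smul_of_tower_mem n h

end Diagonal

end HilbertKunz

namespace HilbertKunz

/-! ### Diagonal forms for pure powers, a linear factor and a square. -/

section Relations

variable {k A B : Type*} [Field k] [CommRing A] [Algebra k A] [Module.Finite k A] [CommRing B]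
  [Algebra A B] [Algebra k B] [IsScalarTower k A B] {j : ℕ} {y : B}
  (τ : A)

theorem finrank_quotient_pow (b : Module.Basis (Fin j) A B) (n : ℕ) (h : B) (hh : h = algebraMap A B τ ^ n) :
    Module.finrank k (B ⧸ Ideal.span {h}) = j * finrankModPow k τ n := by
  classical
  let c : ℕ → B := fun i => if hi : i < j then b ⟨i, hi⟩ else 0
  have hc : ∀ i : Fin j, b i ∈ Submodule.span A (c '' Set.Iio j) := fun i =>
    Submodule.subset_span ⟨i, i.2, by simp [c]⟩
  rw [finrank_quotient_eq_sum b τ c (fun _ => n) c h hc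
    (fun i hi => Submodule.subset_span ⟨i, hi, rfl⟩)
    (fun i _ => hh ▸ Ideal.mul_mem_right _ _ (Ideal.mem_span_singleton_self _))
    (fun i hi => Submodule.subset_span ⟨i, hi, by rw [hh]⟩)]
  simp

/-- In the basis 1, y^i (T + y), the element T + y divides T^j - (-y)^j = T^j. So 1 carries the
exponent n + j and every other basis vector the exponent n. -/
theorem finrank_quotient_linear (b : Module.Basis (Fin j) A B) (hb : ∀ i, b i = y ^ (i : ℕ))
    (hy : y ^ j = 0) (n : ℕ) (h : B)
    (hh : h = algebraMap A B τ ^ n * (algebraMap A B τ + y)) (hj : 0 < j) :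
    Module.finrank k (B ⧸ Ideal.span {h}) = finrankModPow k τ (n + j) +
      (j - 1) * finrankModPow k τ n := by
  obtain ⟨j, rfl⟩ : ∃ j', j = j' + 1 := ⟨j - 1, by omega⟩
  set T := algebraMap A B τ with hT
  let β : ℕ → B := fun i => if i = 0 then 1 else y ^ (i - 1) * (T + y)
  let ex : ℕ → ℕ := fun i => if i = 0 then n + (j + 1) else n
  have hβ0 : β 0 = 1 := rfl
  have hβs : ∀ i, β (i + 1) = y ^ i * (T + y) := fun i => rfl
  have hex0 : ex 0 = n + (j + 1) := rfl
  have hexs : ∀ i, ex (i + 1) = n := fun i => rfl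
  have hmem : ∀ i < j + 1, T ^ ex i * β i ∈
      Submodule.span A ((fun i => T ^ ex i * β i) '' Set.Iio (j + 1)) := fun i hi =>
    Submodule.subset_span ⟨i, hi, rfl⟩
  -- The multiples of T^n y^i (T + y) trade a factor T for a factor y, up to sign, starting from
  -- T^(n+j). The last exchange reaches T^(n+1) y^(j-1), which is h y^(j-1).
  have hlast : ∀ i < j + 1, T ^ (n + (j + 1) - i) * y ^ i ∈
      Submodule.span A ((fun i => T ^ ex i * β i) '' Set.Iio (j + 1)) := by
    intro i
    induction i with
    | zero => intro hi; simpa [hex0, hβ0] using hmem 0 hi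
    | succ i ih =>
      intro hi
      have h1 := hmem (i + 1) hi
      rw [hexs, hβs] at h1
      have h2 : T ^ (n + (j + 1) - (i + 1)) * y ^ (i + 1) =
          T ^ (j - i) * (T ^ n * (y ^ i * (T + y))) - T ^ (n + (j + 1) - i) * y ^ i := by
        rw [show n + (j + 1) - (i + 1) = (j - i) + n by omega,
          show n + (j + 1) - i = (j - i) + n + 1 by omega]
        ring
      rw [h2]
      exact Submodule.sub_mem _ (algebraMap_pow_mul_mem τ _ h1) (ih (by omega))
  have hpow : ∀ i < j + 1, y ^ i ∈ Submodule.span A (β '' Set.Iio (j + 1)) := by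
    intro i
    induction i with
    | zero => intro hi; exact Submodule.subset_span ⟨0, hi, by simp [hβ0]⟩
    | succ i ih =>
      intro hi
      have h2 : y ^ (i + 1) = β (i + 1) - T ^ 1 * y ^ i := by rw [hβs]; ring
      rw [h2]
      exact Submodule.sub_mem _ (Submodule.subset_span ⟨i + 1, hi, rfl⟩)
        (algebraMap_pow_mul_mem τ _ (ih (by omega)))
  rw [finrank_quotient_eq_sum b τ β ex (fun i => y ^ i) h
    (fun i => Submodule.subset_span ⟨i, i.2, (hb i).symm⟩) hpow]
  · rw [Finset.sum_range_succ']
    simp [hex0, hexs, add_comm]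
  · intro i hi
    rw [Ideal.mem_span_singleton, ← hT]
    rcases i with _ | i
    · rw [hex0, hβ0, mul_one, hh, pow_add]
      refine mul_dvd_mul_left _ ?_
      have := sub_dvd_pow_sub_pow T (-y) (j + 1)
      rwa [sub_neg_eq_add, neg_pow, hy, mul_zero, sub_zero] at this
    · exact ⟨y ^ i, by rw [hexs, hβs, hh]; ring⟩
  · intro i hi
    rw [← hT]
    by_cases hij : i < j
    · have h1 := hmem (i + 1) (by omega)
      rw [hexs, hβs] at h1
      convert h1 using 1
      rw [hh]; ring
    · obtain rfl : i = j := by omega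
      have h1 := hlast i hi
      convert h1 using 1
      rw [hh, show n + (i + 1) - i = n + 1 by omega]
      linear_combination T ^ n * hy

/-- Even and odd powers of y separate, and y^2 acts on them as a nilpotent block of size a + 1 and
of size a. These give the exponent a + 1 at 1 and a at y; all other basis vectors are multiples of T
+ y^2. -/
theorem finrank_quotient_add_sq (b : Module.Basis (Fin j) A B) (hb : ∀ i, b i = y ^ (i : ℕ))
    (hy : y ^ j = 0) (a : ℕ)
    (hj : j = 2 * a + 1) :
    Module.finrank k (B ⧸ Ideal.span {algebraMap A B τ + y ^ 2}) =
      finrankModPow k τ a +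
        finrankModPow k τ (a + 1) := by
  subst hj
  set T := algebraMap A B τ with hT
  let β : ℕ → B := fun i => if i = 0 then 1 else if i = 1 then y else y ^ (i - 2) * (T + y ^ 2)
  let ex : ℕ → ℕ := fun i => if i = 0 then a + 1 else if i = 1 then a else 0
  have hβ0 : β 0 = 1 := rfl
  have hβ1 : β 1 = y := rfl
  have hβs : ∀ i, β (i + 2) = y ^ i * (T + y ^ 2) := fun i => rfl
  have hex0 : ex 0 = a + 1 := rfl
  have hex1 : ex 1 = a := rfl
  have hexs : ∀ i, ex (i + 2) = 0 := fun i => rfl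
  have hmem : ∀ i < 2 * a + 1, T ^ ex i * β i ∈
      Submodule.span A ((fun i => T ^ ex i * β i) '' Set.Iio (2 * a + 1)) := fun i hi =>
    Submodule.subset_span ⟨i, hi, rfl⟩
  have heven : ∀ s, 2 * s < 2 * a + 1 → T ^ (a + 1 - s) * y ^ (2 * s) ∈
      Submodule.span A ((fun i => T ^ ex i * β i) '' Set.Iio (2 * a + 1)) := by
    intro s
    induction s with
    | zero => intro hi; simpa [hex0, hβ0] using hmem 0 hi
    | succ s ih =>
      intro hi
      have h1 := hmem (2 * s + 2) hi
      rw [hexs, hβs] at h1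
      have h2 : T ^ (a + 1 - (s + 1)) * y ^ (2 * (s + 1)) =
          T ^ (a - s) * (T ^ 0 * (y ^ (2 * s) * (T + y ^ 2))) - T ^ (a + 1 - s) * y ^ (2 * s) := by
        rw [show a + 1 - (s + 1) = a - s by omega, show a + 1 - s = (a - s) + 1 by omega]
        ring
      rw [h2]
      exact Submodule.sub_mem _ (algebraMap_pow_mul_mem τ _ h1) (ih (by omega))
  have hodd : ∀ s, 2 * s + 1 < 2 * a + 1 → T ^ (a - s) * y ^ (2 * s + 1) ∈
      Submodule.span A ((fun i => T ^ ex i * β i) '' Set.Iio (2 * a + 1)) := by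
    intro s
    induction s with
    | zero => intro hi; simpa [hex1, hβ1] using hmem 1 hi
    | succ s ih =>
      intro hi
      have h1 := hmem (2 * s + 1 + 2) hi
      rw [hexs, hβs] at h1
      have h2 : T ^ (a - (s + 1)) * y ^ (2 * (s + 1) + 1) =
          T ^ (a - (s + 1)) * (T ^ 0 * (y ^ (2 * s + 1) * (T + y ^ 2))) -
            T ^ (a - s) * y ^ (2 * s + 1) := by
        rw [show a - s = (a - (s + 1)) + 1 by omega]
        ring
      rw [h2]
      exact Submodule.sub_mem _ (algebraMap_pow_mul_mem τ _ h1) (ih (by omega))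
  have hpow : ∀ i < 2 * a + 1, y ^ i ∈ Submodule.span A (β '' Set.Iio (2 * a + 1)) := by
    intro i
    induction i using Nat.twoStepInduction with
    | zero => intro hi; exact Submodule.subset_span ⟨0, hi, by simp [hβ0]⟩
    | one => intro hi; exact Submodule.subset_span ⟨1, hi, by simp [hβ1]⟩
    | more i ih _ =>
      intro hi
      have h2 : y ^ (i + 2) = β (i + 2) - T ^ 1 * y ^ i := by rw [hβs]; ring
      rw [h2]
      exact Submodule.sub_mem _ (Submodule.subset_span ⟨i + 2, hi, rfl⟩)
        (algebraMap_pow_mul_mem τ _ (ih (by omega)))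
  rw [finrank_quotient_eq_sum b τ β ex (fun i => y ^ i) _
    (fun i => Submodule.subset_span ⟨i, i.2, (hb i).symm⟩) hpow]
  · rcases a with _ | a
    · simp [hex0, finrankModPow_zero]
    · rw [show 2 * (a + 1) + 1 = 2 * a + 1 + 1 + 1 by ring, Finset.sum_range_succ',
        Finset.sum_range_succ']
      simp only [hexs, finrankModPow_zero, hex0, zero_add, hex1, Finset.sum_const_zero]
  · intro i hi
    rw [Ideal.mem_span_singleton, ← hT]
    have hdvd : ∀ n, T + y ^ 2 ∣ T ^ n - (-y ^ 2) ^ n := fun n => by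
      have := sub_dvd_pow_sub_pow T (-y ^ 2) n
      rwa [sub_neg_eq_add] at this
    rcases i with _ | _ | i
    · rw [hex0, hβ0, mul_one]
      have := hdvd (a + 1)
      rwa [neg_pow, ← pow_mul, show 2 * (a + 1) = 2 * a + 1 + 1 by ring, pow_succ y (2 * a + 1), hy,
        zero_mul, mul_zero, sub_zero] at this
    · have h1 := Dvd.dvd.mul_right (hdvd a) y
      rwa [sub_mul, neg_pow, ← pow_mul, mul_assoc, ← pow_succ, hy, mul_zero, sub_zero] at h1
    · exact ⟨y ^ i, by rw [hexs, hβs]; ring⟩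
  · intro i hi
    rw [← hT]
    by_cases hij : i + 2 < 2 * a + 1
    · have h1 := hmem (i + 2) (by omega)
      rw [hexs, hβs] at h1
      convert h1 using 1
      ring
    · rcases Nat.even_or_odd' i with ⟨s, rfl | rfl⟩
      · obtain rfl : s = a := by omega
        have h1 := heven s hi
        convert h1 using 1
        rw [show s + 1 - s = 1 by omega]
        linear_combination y * hy
      · obtain rfl : a = s + 1 := by omega
        have h1 := hodd s hi
        convert h1 using 1
        rw [show s + 1 - s = 1 by omega]
        linear_combination hy

end Relations

end HilbertKunz

namespace HilbertKunz

/-! ### Powers of τ + y with exponent divisible by q, when y^(q+1) = 0. -/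

section FrobeniusRelations

variable {k A B : Type*} [Field k] [CommRing A] [Algebra k A] [CommRing B]
  [Algebra A B] [Algebra k B] [IsScalarTower k A B]

/-- Since y annihilates y^q, the element T + y acts on y^q as T. -/
theorem mul_eq_of_pow_succ_eq_zero {q : ℕ} {T y : B} (hy : y ^ (q + 1) = 0) (n : ℕ) :
    (T + y) ^ n * y ^ q = T ^ n * y ^ q := by
  induction n with
  | zero => simp
  | succ n ih =>
    rw [pow_succ, mul_right_comm, ih]
    linear_combination T ^ n * hy

/-- This is (T^q + y^q)^(i+1) with y^(2q) = 0: two binomial terms survive. The coefficient i + 1 is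
why the later cases depend on its vanishing in k. -/
theorem pow_mul_eq_of_pow_succ_eq_zero {q : ℕ} (hq : 0 < q) {T y : B} (hy : y ^ (q + 1) = 0)
    (hf : (T + y) ^ q = T ^ q + y ^ q) (i : ℕ) :
    (T + y) ^ (q * (i + 1)) = T ^ (q * (i + 1)) + ((i + 1 : ℕ) : B) * T ^ (q * i) * y ^ q := by
  have hsq : y ^ q * y ^ q = 0 := by
    rw [← pow_add]
    exact pow_eq_zero_of_le (by omega) hy
  induction i with
  | zero => simp [hf]
  | succ i ih =>
    rw [Nat.mul_succ, pow_add, ih, hf]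
    push_cast
    linear_combination ((i : B) + 1) * T ^ (q * i) * hsq

theorem pow_mem_span_add_pow {q : ℕ} (τ : A) (y : B) (c : ℕ → B)
    (hc : ∀ i < q, c i = (algebraMap A B τ + y) ^ i) (hcq : c q = y ^ q) (i : ℕ) (hi : i < q + 1) :
    y ^ i ∈ Submodule.span A (c '' Set.Iio (q + 1)) := by
  by_cases hiq : i = q
  · subst hiq
    exact Submodule.subset_span ⟨i, hi, hcq⟩
  · have : y ^ i = ((algebraMap A B τ + y) + algebraMap A B (-τ)) ^ i := by
      rw [map_neg]; ring
    rw [this, add_pow]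
    refine Submodule.sum_mem _ fun l hl => ?_
    rw [Finset.mem_range] at hl
    rw [mul_comm, mul_comm _ (algebraMap A B (-τ) ^ _)]
    refine natCast_mul_mem _ (algebraMap_pow_mul_mem _ _ (Submodule.subset_span ⟨l, ?_, ?_⟩))
    · exact Set.mem_Iio.mpr (by omega)
    · exact hc l (by omega)

variable [Module.Finite k A] {q : ℕ} {y : B} (τ : A) (b : Module.Basis (Fin (q + 1)) A B)

/-- With h = x^(q(i+1)), three combinations diagonalise the ideal: h = T^(qi) ((i+1) y^q + T^q), h
x^l - T^l h = T^(q(i+1)) (x^l - T^l), and T^q h - (i+1) h y^q = T^(q(i+2)). Invertibility of i + 1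
recovers y^q from the new basis. -/
theorem finrank_quotient_frobenius_mul (hb : ∀ i, b i = y ^ (i : ℕ)) (hy : y ^ (q + 1) = 0)
    (hq : 0 < q) (hf : (algebraMap A B τ + y) ^ q = algebraMap A B τ ^ q + y ^ q) (i : ℕ)
    (hi : ((i + 1 : ℕ) : k) ≠ 0) :
    Module.finrank k (B ⧸ Ideal.span {(algebraMap A B τ + y) ^ (q * (i + 1))}) =
      finrankModPow k τ (q * (i + 2)) + finrankModPow k τ (q * i) +
        (q - 1) * finrankModPow k τ (q * (i + 1)) := by
  set T := algebraMap A B τ with hT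
  set x := T + y with hx
  obtain ⟨h, hh⟩ : ∃ h, h = x ^ (q * (i + 1)) := ⟨_, rfl⟩
  rw [← hh]
  let c : ℕ → B := fun l => if l = q then y ^ q else x ^ l
  let β : ℕ → B := fun l => if l = q then ((i + 1 : ℕ) : B) * y ^ q + T ^ q else
    if l = 0 then 1 else x ^ l - T ^ l
  let ex : ℕ → ℕ := fun l => if l = q then q * i else if l = 0 then q * (i + 2) else q * (i + 1)
  have hcq : c q = y ^ q := if_pos rfl
  have hcl : ∀ l < q, c l = x ^ l := fun l hl => if_neg hl.ne
  have hβq : β q = ((i + 1 : ℕ) : B) * y ^ q + T ^ q := if_pos rfl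
  have hexq : ex q = q * i := if_pos rfl
  have hβ0 : β 0 = 1 := by simp [β, hq.ne]
  have hex0 : ex 0 = q * (i + 2) := by simp [ex, hq.ne]
  have hβl : ∀ l, 0 < l → l < q → β l = x ^ l - T ^ l := fun l h0 hl => by
    simp [β, hl.ne, h0.ne']
  have hexl : ∀ l, 0 < l → l < q → ex l = q * (i + 1) := fun l h0 hl => by
    simp [ex, hl.ne, h0.ne']
  have hhx : h = T ^ (q * (i + 1)) + ((i + 1 : ℕ) : B) * T ^ (q * i) * y ^ q :=
    hh.trans (pow_mul_eq_of_pow_succ_eq_zero hq hy hf i)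
  have hxH : ∀ n, x ^ n * y ^ q = T ^ n * y ^ q := mul_eq_of_pow_succ_eq_zero hy
  have hhH : h * y ^ q = T ^ (q * (i + 1)) * y ^ q := hh ▸ hxH _
  have eq_q : T ^ ex q * β q = h := by
    rw [hexq, hβq, hhx]; ring
  have eq_l : ∀ l, 0 < l → l < q → T ^ ex l * β l = h * x ^ l - T ^ l * h := fun l h0 hl => by
    rw [hexl l h0 hl, hβl l h0 hl, hhx]
    linear_combination -((i + 1 : ℕ) : B) * T ^ (q * i) * hxH l
  have eq_0 : T ^ ex 0 * β 0 = T ^ q * h - ((i + 1 : ℕ) : B) * (h * y ^ q) := by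
    rw [hex0, hβ0, hhH, hhx]; ring
  have hmem : ∀ l < q + 1, T ^ ex l * β l ∈
      Submodule.span A ((fun l => T ^ ex l * β l) '' Set.Iio (q + 1)) := fun l hl =>
    Submodule.subset_span ⟨l, hl, rfl⟩
  have hmemβ : ∀ l < q + 1, β l ∈ Submodule.span A (β '' Set.Iio (q + 1)) := fun l hl =>
    Submodule.subset_span ⟨l, hl, rfl⟩
  have h1mem : (1 : B) ∈ Submodule.span A (β '' Set.Iio (q + 1)) := hβ0 ▸ hmemβ 0 (by omega)
  have hTmem : ∀ n, T ^ n ∈ Submodule.span A (β '' Set.Iio (q + 1)) := fun n => by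
    simpa using algebraMap_pow_mul_mem τ n h1mem
  rw [finrank_quotient_eq_sum b τ β ex c h
    (fun i => hb i ▸ pow_mem_span_add_pow τ y c hcl hcq i i.2)]
  · rw [Finset.sum_range_succ, hexq]
    obtain ⟨q, rfl⟩ : ∃ q', q = q' + 1 := ⟨q - 1, by omega⟩
    rw [Finset.sum_range_succ', hex0, Finset.sum_congr rfl fun l hl => by
      rw [hexl (l + 1) (by omega) (by simpa using hl)]]
    simp only [Finset.sum_const, Finset.card_range, smul_eq_mul, Nat.add_sub_cancel]
    ring
  · intro l hl
    by_cases hlq : l = q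
    · rw [hlq, hcq]
      refine mem_of_natCast_mul_mem hi ?_
      have : ((i + 1 : ℕ) : B) * y ^ q = β q - T ^ q := by rw [hβq]; ring
      rw [this]
      exact Submodule.sub_mem _ (hmemβ q (by omega)) (hTmem q)
    · rw [hcl l (by omega)]
      rcases Nat.eq_zero_or_pos l with rfl | h0
      · rwa [pow_zero]
      · have : x ^ l = β l + T ^ l := by rw [hβl l h0 (by omega)]; ring
        rw [this]
        exact Submodule.add_mem _ (hmemβ l hl) (hTmem l)
  · intro l hl
    have hself := Ideal.mem_span_singleton_self h
    by_cases hlq : l = q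
    · rw [hlq, eq_q]; exact hself
    · rcases Nat.eq_zero_or_pos l with rfl | h0
      · rw [eq_0]
        exact Ideal.sub_mem _ (Ideal.mul_mem_left _ _ hself)
          (Ideal.mul_mem_left _ _ (Ideal.mul_mem_right _ _ hself))
      · rw [eq_l l h0 (by omega)]
        exact Ideal.sub_mem _ (Ideal.mul_mem_right _ _ hself) (Ideal.mul_mem_left _ _ hself)
  · intro l hl
    have hhmem := eq_q ▸ hmem q (by omega)
    by_cases hlq : l = q
    · rw [hlq, hcq]
      refine mem_of_natCast_mul_mem hi ?_
      have : ((i + 1 : ℕ) : B) * (h * y ^ q) = T ^ q * h - T ^ ex 0 * β 0 := by rw [eq_0]; ring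
      rw [this]
      exact Submodule.sub_mem _ (algebraMap_pow_mul_mem τ q hhmem) (hmem 0 (by omega))
    · rw [hcl l (by omega)]
      rcases Nat.eq_zero_or_pos l with rfl | h0
      · rwa [pow_zero, mul_one]
      · have : h * x ^ l = T ^ ex l * β l + T ^ l * h := by rw [eq_l l h0 (by omega)]; ring
        rw [this]
        exact Submodule.add_mem _ (hmem l hl) (algebraMap_pow_mul_mem τ l hhmem)

end FrobeniusRelations

end HilbertKunz

namespace HilbertKunz

/-! ### Powers of τ + y with exponent q (i + 1) + m, where q = m + r. -/

section FrobeniusRelations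

variable {k A B : Type*} [Field k] [CommRing A] [Algebra k A] [CommRing B]
  [Algebra A B] [Algebra k B] [IsScalarTower k A B]
  [Module.Finite k A] {m r : ℕ} {y : B} (τ : A) (b : Module.Basis (Fin (m + r + 1)) A B)

/-- The dimension of `B / (x ^ M)` with `M = (m + r) * (i + 1) + m`, given a diagonal form of the
part spanned by `x ^ 0, …, x ^ m`. -/
theorem finrank_quotient_frobenius_aux (hb : ∀ i, b i = y ^ (i : ℕ)) (hy : y ^ (m + r + 1) = 0)
    (hr : 0 < r)
    (hf : (algebraMap A B τ + y) ^ (m + r) = algebraMap A B τ ^ (m + r) + y ^ (m + r)) (i : ℕ)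
    (hi : ((i + 1 : ℕ) : k) ≠ 0) (h : B) (hh : h = (algebraMap A B τ + y) ^ ((m + r) * (i + 1) + m))
    (γ : ℕ → B) (g : ℕ → ℕ)
    (hspan : ∀ l ≤ m, (algebraMap A B τ + y) ^ l ∈ Submodule.span A (γ '' Set.Iic m))
    (hle : ∀ l ≤ m, algebraMap A B τ ^ g l * γ l ∈ Ideal.span {h})
    (hge : ∀ l < m, h * (algebraMap A B τ + y) ^ (r + l) ∈ Submodule.span A
      (insert h ((fun l => algebraMap A B τ ^ g l * γ l) '' Set.Iic m)))
    (hge' : h * y ^ (m + r) ∈ Submodule.span A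
      (insert h ((fun l => algebraMap A B τ ^ g l * γ l) '' Set.Iic m))) :
    Module.finrank k (B ⧸ Ideal.span {h}) = finrankModPow k τ ((m + r) * i + m) +
      (r - 1) * finrankModPow k τ ((m + r) * (i + 1)) +
        ∑ l ∈ Finset.range (m + 1), finrankModPow k τ (g l) := by
  set T := algebraMap A B τ with hT
  set x := T + y with hx
  let c : ℕ → B := fun l => if l = m + r then y ^ (m + r) else x ^ l
  -- With q = m + r, the top vector is chosen so that T^(qi+m) times it is h. For m < l < q, the
  -- vector times T^(q(i+1)) is h x^(l-m) - T^(l-m) h, where the y^q terms cancel. The positions l ≤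
  -- m are left to `γ`.
  let β : ℕ → B := fun l => if l = m + r then ((i + 1 : ℕ) : B) * y ^ (m + r) + T ^ r * x ^ m else
    if l ≤ m then γ l else x ^ l - T ^ (l - m) * x ^ m
  let ex : ℕ → ℕ := fun l => if l = m + r then (m + r) * i + m else
    if l ≤ m then g l else (m + r) * (i + 1)
  have hcq : c (m + r) = y ^ (m + r) := if_pos rfl
  have hcl : ∀ l < m + r, c l = x ^ l := fun l hl => if_neg hl.ne
  have hβq : β (m + r) = ((i + 1 : ℕ) : B) * y ^ (m + r) + T ^ r * x ^ m := if_pos rfl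
  have hexq : ex (m + r) = (m + r) * i + m := if_pos rfl
  have hβ0 : ∀ l ≤ m, β l = γ l := fun l hl => by
    have : l ≠ m + r := by omega
    simp [β, hl, this]
  have hex0 : ∀ l ≤ m, ex l = g l := fun l hl => by
    have : l ≠ m + r := by omega
    simp [ex, hl, this]
  have hβl : ∀ l, m < l → l < m + r → β l = x ^ l - T ^ (l - m) * x ^ m := fun l h0 hl => by
    simp [β, hl.ne, h0.not_ge]
  have hexl : ∀ l, m < l → l < m + r → ex l = (m + r) * (i + 1) := fun l h0 hl => by
    simp [ex, hl.ne, h0.not_ge]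
  have hxH : ∀ n, x ^ n * y ^ (m + r) = T ^ n * y ^ (m + r) := mul_eq_of_pow_succ_eq_zero hy
  have hhx : ∀ l, h * x ^ l = T ^ ((m + r) * (i + 1)) * x ^ (m + l) +
      ((i + 1 : ℕ) : B) * T ^ ((m + r) * i + m + l) * y ^ (m + r) := fun l => by
    rw [hh, pow_add, pow_mul_eq_of_pow_succ_eq_zero (by omega) hy hf i]
    linear_combination ((i + 1 : ℕ) : B) * T ^ ((m + r) * i) * hxH (m + l)
  have eq_q : T ^ ex (m + r) * β (m + r) = h := by
    have := hhx 0
    rw [pow_zero, mul_one] at this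
    rw [hexq, hβq, this]
    ring
  have eq_l : ∀ l, m < l → l < m + r → T ^ ex l * β l = h * x ^ (l - m) - T ^ (l - m) * h := by
    intro l h0 hl
    have := hhx 0
    rw [pow_zero, mul_one] at this
    rw [hexl l h0 hl, hβl l h0 hl, hhx, this, show m + (l - m) = l by omega]
    ring
  have hmem : ∀ l < m + r + 1, T ^ ex l * β l ∈
      Submodule.span A ((fun l => T ^ ex l * β l) '' Set.Iio (m + r + 1)) := fun l hl =>
    Submodule.subset_span ⟨l, hl, rfl⟩
  have hmemβ : ∀ l < m + r + 1, β l ∈ Submodule.span A (β '' Set.Iio (m + r + 1)) := fun l hl =>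
    Submodule.subset_span ⟨l, hl, rfl⟩
  have hγ : Submodule.span A (γ '' Set.Iic m) ≤ Submodule.span A (β '' Set.Iio (m + r + 1)) := by
    rw [Submodule.span_le]
    rintro _ ⟨l, hl, rfl⟩
    rw [← hβ0 l hl]
    exact hmemβ l (by have := Set.mem_Iic.mp hl; omega)
  have hhmem := eq_q ▸ hmem (m + r) (by omega)
  have hγ' : Submodule.span A (insert h ((fun l => T ^ g l * γ l) '' Set.Iic m)) ≤
      Submodule.span A ((fun l => T ^ ex l * β l) '' Set.Iio (m + r + 1)) := by
    rw [Submodule.span_le]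
    rintro _ (rfl | ⟨l, hl, rfl⟩)
    · exact hhmem
    · change T ^ g l * γ l ∈ _
      rw [← hβ0 l hl, ← hex0 l hl]
      exact hmem l (by have := Set.mem_Iic.mp hl; omega)
  rw [finrank_quotient_eq_sum b τ β ex c h
    (fun i => hb i ▸ pow_mem_span_add_pow τ y c hcl hcq i i.2)]
  · rw [Finset.sum_range_succ, hexq]
    obtain ⟨r, rfl⟩ : ∃ r', r = r' + 1 := ⟨r - 1, by omega⟩
    rw [show m + (r + 1) = (m + 1) + r by ring, Finset.sum_range_add,
      Finset.sum_congr rfl fun l hl => by rw [hex0 l (by have := Finset.mem_range.mp hl; omega)],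
      Finset.sum_congr (s₁ := Finset.range r) rfl fun l hl => by
        rw [hexl (m + 1 + l) (by omega) (by have := Finset.mem_range.mp hl; omega)]]
    simp only [Finset.sum_const, Finset.card_range, smul_eq_mul, Nat.add_sub_cancel]
    rw [show m + (r + 1) = (m + 1) + r by ring]
    ring
  · intro l hl
    by_cases hlq : l = m + r
    · rw [hlq, hcq]
      refine mem_of_natCast_mul_mem hi ?_
      have : ((i + 1 : ℕ) : B) * y ^ (m + r) = β (m + r) - T ^ r * x ^ m := by rw [hβq]; ring
      rw [this]
      exact Submodule.sub_mem _ (hmemβ _ (by omega))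
        (algebraMap_pow_mul_mem τ r (hγ (hspan m le_rfl)))
    · rw [hcl l (by omega)]
      by_cases h0 : l ≤ m
      · exact hγ (hspan l h0)
      · have : x ^ l = β l + T ^ (l - m) * x ^ m := by
          rw [hβl l (by omega) (by omega)]; ring
        rw [this]
        exact Submodule.add_mem _ (hmemβ l hl) (algebraMap_pow_mul_mem τ _ (hγ (hspan m le_rfl)))
  · intro l hl
    have hself := Ideal.mem_span_singleton_self h
    by_cases hlq : l = m + r
    · rw [hlq, eq_q]; exact hself
    · by_cases h0 : l ≤ m
      · rw [hex0 l h0, hβ0 l h0]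
        exact hle l h0
      · rw [eq_l l (by omega) (by omega)]
        exact Ideal.sub_mem _ (Ideal.mul_mem_right _ _ hself) (Ideal.mul_mem_left _ _ hself)
  · intro l hl
    by_cases hlq : l = m + r
    · rw [hlq, hcq]
      exact hγ' hge'
    · rw [hcl l (by omega)]
      by_cases hlr : r ≤ l
      · obtain ⟨l, rfl⟩ := Nat.exists_eq_add_of_le hlr
        exact hγ' (hge l (by omega))
      · rcases Nat.eq_zero_or_pos l with rfl | h0
        · rwa [pow_zero, mul_one]
        · have : h * x ^ l = T ^ ex (m + l) * β (m + l) + T ^ l * h := by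
            rw [eq_l (m + l) (by omega) (by omega), Nat.add_sub_cancel_left]; ring
          rw [this]
          exact Submodule.add_mem _ (hmem _ (by omega)) (algebraMap_pow_mul_mem τ l hhmem)

/-- Multiplying h by x^r reaches the next multiple of q: h x^r = T^(q(i+2)) + (i+2) T^(q(i+1)) y^q.
Eliminating y^q against h gives (i+1) h x^r - (i+2) T^r h = T^(q(i+1)+r) ((i+1) T^m - (i+2) x^m),
and against h y^q gives T^(q(i+2)+m). Both coefficients must be units to invert the change of basis.
-/
theorem finrank_quotient_frobenius (hb : ∀ i, b i = y ^ (i : ℕ)) (hy : y ^ (m + r + 1) = 0)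
    (hm : 0 < m) (hr : 0 < r)
    (hf : (algebraMap A B τ + y) ^ (m + r) = algebraMap A B τ ^ (m + r) + y ^ (m + r)) (i : ℕ)
    (hi : ((i + 1 : ℕ) : k) ≠ 0) (hi' : ((i + 2 : ℕ) : k) ≠ 0) :
    Module.finrank k (B ⧸ Ideal.span {(algebraMap A B τ + y) ^ ((m + r) * (i + 1) + m)}) =
      finrankModPow k τ ((m + r) * i + m) + finrankModPow k τ ((m + r) * (i + 1) + r) +
        finrankModPow k τ ((m + r) * (i + 2) + m) + (m - 1) * finrankModPow k τ ((m + r) * (i + 2))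
        + (r - 1) * finrankModPow k τ ((m + r) * (i + 1)) := by
  set T := algebraMap A B τ with hT
  set x := T + y with hx
  obtain ⟨h, hh⟩ : ∃ h, h = x ^ ((m + r) * (i + 1) + m) := ⟨_, rfl⟩
  rw [← hh]
  let γ : ℕ → B := fun l => if l = m then ((i + 1 : ℕ) : B) * T ^ m - ((i + 2 : ℕ) : B) * x ^ m else
    if l = 0 then 1 else x ^ l - T ^ l
  let g : ℕ → ℕ := fun l => if l = m then (m + r) * (i + 1) + r else
    if l = 0 then (m + r) * (i + 2) + m else (m + r) * (i + 2)
  have hγm : γ m = ((i + 1 : ℕ) : B) * T ^ m - ((i + 2 : ℕ) : B) * x ^ m := if_pos rfl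
  have hgm : g m = (m + r) * (i + 1) + r := if_pos rfl
  have hγ0 : γ 0 = 1 := by simp [γ, hm.ne]
  have hg0 : g 0 = (m + r) * (i + 2) + m := by simp [g, hm.ne]
  have hγl : ∀ l, 0 < l → l < m → γ l = x ^ l - T ^ l := fun l h0 hl => by
    simp [γ, hl.ne, h0.ne']
  have hgl : ∀ l, 0 < l → l < m → g l = (m + r) * (i + 2) := fun l h0 hl => by
    simp [g, hl.ne, h0.ne']
  have hxH : ∀ n, x ^ n * y ^ (m + r) = T ^ n * y ^ (m + r) := mul_eq_of_pow_succ_eq_zero hy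
  have hhH : h * y ^ (m + r) = T ^ ((m + r) * (i + 1) + m) * y ^ (m + r) := hh ▸ hxH _
  have hh0 : h = T ^ ((m + r) * (i + 1)) * x ^ m +
      ((i + 1 : ℕ) : B) * T ^ ((m + r) * i + m) * y ^ (m + r) := by
    rw [hh, pow_add, pow_mul_eq_of_pow_succ_eq_zero (by omega) hy hf i]
    linear_combination ((i + 1 : ℕ) : B) * T ^ ((m + r) * i) * hxH m
  have hhx : ∀ l, h * x ^ (r + l) = T ^ ((m + r) * (i + 2)) * x ^ l +
      ((i + 2 : ℕ) : B) * T ^ ((m + r) * (i + 1) + l) * y ^ (m + r) := fun l => by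
    have : h * x ^ (r + l) = x ^ ((m + r) * (i + 1 + 1)) * x ^ l := by rw [hh]; ring
    rw [this, pow_mul_eq_of_pow_succ_eq_zero (by omega) hy hf (i + 1)]
    linear_combination ((i + 2 : ℕ) : B) * T ^ ((m + r) * (i + 1)) * hxH l
  have hhr : h * x ^ r = T ^ ((m + r) * (i + 2)) +
      ((i + 2 : ℕ) : B) * T ^ ((m + r) * (i + 1)) * y ^ (m + r) := by
    have := hhx 0
    rwa [add_zero, add_zero, pow_zero, mul_one] at this
  have eq_m : T ^ g m * γ m = ((i + 1 : ℕ) : B) * (h * x ^ r) - ((i + 2 : ℕ) : B) * (T ^ r * h) := by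
    rw [hgm, hγm, hhr, hh0]; ring
  have eq_0 : T ^ g 0 * γ 0 = T ^ m * (h * x ^ r) - ((i + 2 : ℕ) : B) * (h * y ^ (m + r)) := by
    rw [hg0, hγ0, hhr, hhH]; ring
  have eq_l : ∀ l, 0 < l → l < m → T ^ g l * γ l = h * x ^ (r + l) - T ^ l * (h * x ^ r) := by
    intro l h0 hl
    rw [hgl l h0 hl, hγl l h0 hl, hhx, hhr]; ring
  have hmemγ : ∀ l ≤ m, γ l ∈ Submodule.span A (γ '' Set.Iic m) := fun l hl =>
    Submodule.subset_span ⟨l, hl, rfl⟩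
  have hTmem : ∀ n, T ^ n ∈ Submodule.span A (γ '' Set.Iic m) := fun n => by
    have := algebraMap_pow_mul_mem τ n (hmemγ 0 (by omega))
    rwa [hγ0, mul_one] at this
  have hmem : ∀ l ≤ m, T ^ g l * γ l ∈
      Submodule.span A (insert h ((fun l => T ^ g l * γ l) '' Set.Iic m)) := fun l hl =>
    Submodule.subset_span (Or.inr ⟨l, hl, rfl⟩)
  have hhmem : h ∈ Submodule.span A (insert h ((fun l => T ^ g l * γ l) '' Set.Iic m)) :=
    Submodule.subset_span (Or.inl rfl)
  have hhrmem : h * x ^ r ∈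
      Submodule.span A (insert h ((fun l => T ^ g l * γ l) '' Set.Iic m)) := by
    refine mem_of_natCast_mul_mem hi ?_
    have : ((i + 1 : ℕ) : B) * (h * x ^ r) =
        T ^ g m * γ m + ((i + 2 : ℕ) : B) * (T ^ r * h) := by rw [eq_m]; ring
    rw [this]
    exact Submodule.add_mem _ (hmem m le_rfl) (natCast_mul_mem _ (algebraMap_pow_mul_mem τ r hhmem))
  rw [finrank_quotient_frobenius_aux τ b hb hy hr hf i hi h hh γ g]
  · rw [Finset.sum_range_succ, hgm]
    obtain ⟨m, rfl⟩ : ∃ m', m = m' + 1 := ⟨m - 1, by omega⟩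
    rw [Finset.sum_range_succ', hg0, Finset.sum_congr rfl fun l hl => by
      rw [hgl (l + 1) (by omega) (by simpa using hl)]]
    simp only [Finset.sum_const, Finset.card_range, smul_eq_mul, Nat.add_sub_cancel]
    ring
  · intro l hl
    rcases hl.eq_or_lt with rfl | hl
    · refine mem_of_natCast_mul_mem hi' ?_
      have : ((i + 2 : ℕ) : B) * x ^ l = ((i + 1 : ℕ) : B) * T ^ l - γ l := by rw [hγm]; ring
      rw [this]
      exact Submodule.sub_mem _ (natCast_mul_mem _ (hTmem l)) (hmemγ l le_rfl)
    · rcases Nat.eq_zero_or_pos l with rfl | h0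
      · rw [pow_zero, ← hγ0]; exact hmemγ 0 hl.le
      · have : x ^ l = γ l + T ^ l := by rw [hγl l h0 hl]; ring
        rw [this]
        exact Submodule.add_mem _ (hmemγ l hl.le) (hTmem l)
  · intro l hl
    have hself := Ideal.mem_span_singleton_self h
    rcases hl.eq_or_lt with rfl | hl
    · rw [eq_m]
      exact Ideal.sub_mem _ (Ideal.mul_mem_left _ _ (Ideal.mul_mem_right _ _ hself))
        (Ideal.mul_mem_left _ _ (Ideal.mul_mem_left _ _ hself))
    · rcases Nat.eq_zero_or_pos l with rfl | h0
      · rw [eq_0]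
        exact Ideal.sub_mem _ (Ideal.mul_mem_left _ _ (Ideal.mul_mem_right _ _ hself))
          (Ideal.mul_mem_left _ _ (Ideal.mul_mem_right _ _ hself))
      · rw [eq_l l h0 hl]
        exact Ideal.sub_mem _ (Ideal.mul_mem_right _ _ hself)
          (Ideal.mul_mem_left _ _ (Ideal.mul_mem_right _ _ hself))
  · intro l hl
    rcases Nat.eq_zero_or_pos l with rfl | h0
    · rwa [add_zero]
    · have : h * x ^ (r + l) = T ^ g l * γ l + T ^ l * (h * x ^ r) := by rw [eq_l l h0 hl]; ring
      rw [this]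
      exact Submodule.add_mem _ (hmem l hl.le) (algebraMap_pow_mul_mem τ l hhrmem)
  · refine mem_of_natCast_mul_mem hi' ?_
    have : ((i + 2 : ℕ) : B) * (h * y ^ (m + r)) = T ^ m * (h * x ^ r) - T ^ g 0 * γ 0 := by
      rw [eq_0]; ring
    rw [this]
    exact Submodule.sub_mem _ (algebraMap_pow_mul_mem τ m hhrmem) (hmem 0 (by omega))

/-- Here x^(q(i+2)) = T^(q(i+2)), so h x^(r+l) = T^(q(i+2)) x^l. The powers x^l with l ≤ m already
diagonalise, all with the same exponent. -/
theorem finrank_quotient_frobenius_of_eq_zero (hb : ∀ i, b i = y ^ (i : ℕ))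
    (hy : y ^ (m + r + 1) = 0) (hr : 0 < r)
    (hf : (algebraMap A B τ + y) ^ (m + r) = algebraMap A B τ ^ (m + r) + y ^ (m + r)) (i : ℕ)
    (hi : ((i + 1 : ℕ) : k) ≠ 0) (hi' : ((i + 2 : ℕ) : k) = 0) :
    Module.finrank k (B ⧸ Ideal.span {(algebraMap A B τ + y) ^ ((m + r) * (i + 1) + m)}) =
      finrankModPow k τ ((m + r) * i + m) + (m + 1) * finrankModPow k τ ((m + r) * (i + 2))
        + (r - 1) * finrankModPow k τ ((m + r) * (i + 1)) := by
  set T := algebraMap A B τ with hT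
  set x := T + y with hx
  obtain ⟨h, hh⟩ : ∃ h, h = x ^ ((m + r) * (i + 1) + m) := ⟨_, rfl⟩
  rw [← hh]
  have hzero : ((i + 1 + 1 : ℕ) : B) = 0 := by
    rw [← map_natCast (algebraMap k B), hi', map_zero]
  have hxH : ∀ n, x ^ n * y ^ (m + r) = T ^ n * y ^ (m + r) := mul_eq_of_pow_succ_eq_zero hy
  have hhH : h * y ^ (m + r) = T ^ ((m + r) * (i + 1) + m) * y ^ (m + r) := hh ▸ hxH _
  have hh0 : h = T ^ ((m + r) * (i + 1)) * x ^ m +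
      ((i + 1 : ℕ) : B) * T ^ ((m + r) * i + m) * y ^ (m + r) := by
    rw [hh, pow_add, pow_mul_eq_of_pow_succ_eq_zero (by omega) hy hf i]
    linear_combination ((i + 1 : ℕ) : B) * T ^ ((m + r) * i) * hxH m
  have hhx : ∀ l, h * x ^ (r + l) = T ^ ((m + r) * (i + 2)) * x ^ l := fun l => by
    have : h * x ^ (r + l) = x ^ ((m + r) * (i + 1 + 1)) * x ^ l := by rw [hh]; ring
    rw [this, pow_mul_eq_of_pow_succ_eq_zero (by omega) hy hf (i + 1), hzero]
    ring
  have eq_m : T ^ ((m + r) * (i + 2)) * x ^ m =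
      T ^ (m + r) * h - ((i + 1 : ℕ) : B) * (h * y ^ (m + r)) := by
    rw [hhH, hh0]; ring
  have hmem : ∀ l ≤ m, T ^ ((m + r) * (i + 2)) * x ^ l ∈ Submodule.span A
      (insert h ((fun l => T ^ ((m + r) * (i + 2)) * x ^ l) '' Set.Iic m)) := fun l hl =>
    Submodule.subset_span (Or.inr ⟨l, hl, rfl⟩)
  rw [finrank_quotient_frobenius_aux τ b hb hy hr hf i hi h hh (fun l => x ^ l)
    (fun _ => (m + r) * (i + 2)) fun l hl => Submodule.subset_span ⟨l, hl, rfl⟩]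
  · simp only [Finset.sum_const, Finset.card_range, smul_eq_mul]
    ring
  · intro l hl
    have hself := Ideal.mem_span_singleton_self h
    rcases hl.eq_or_lt with rfl | hl
    · rw [eq_m]
      exact Ideal.sub_mem _ (Ideal.mul_mem_left _ _ hself)
        (Ideal.mul_mem_left _ _ (Ideal.mul_mem_right _ _ hself))
    · rw [← hhx]
      exact Ideal.mul_mem_right _ _ hself
  · intro l hl
    rw [hhx]
    exact hmem l hl.le
  · refine mem_of_natCast_mul_mem hi ?_
    have : ((i + 1 : ℕ) : B) * (h * y ^ (m + r)) =
        T ^ (m + r) * h - T ^ ((m + r) * (i + 2)) * x ^ m := by rw [eq_m]; ring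
    rw [this]
    exact Submodule.sub_mem _ (algebraMap_pow_mul_mem τ _ (Submodule.subset_span (Or.inl rfl)))
      (hmem m le_rfl)

end FrobeniusRelations

end HilbertKunz

namespace HilbertKunz

/-! ### Multiplication rules for the Jordan classes. -/

section JordanRelations

theorem exists_basis_adjoinRoot_X_pow (A : Type*) [CommRing A] (j : ℕ) :
    ∃ b : Module.Basis (Fin j) A (AdjoinRoot (Polynomial.X ^ j : Polynomial A)),
      ∀ i, b i = AdjoinRoot.root (Polynomial.X ^ j : Polynomial A) ^ (i : ℕ) := by
  cases subsingleton_or_nontrivial A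
  · have := Module.subsingleton A (AdjoinRoot (Polynomial.X ^ j : Polynomial A))
    exact ⟨Module.Basis.ofEquivFun 0, fun i => Subsingleton.elim _ _⟩
  · let pb := AdjoinRoot.powerBasis' (Polynomial.monic_X_pow (R := A) j)
    have hdim : pb.dim = j := Polynomial.natDegree_X_pow j
    refine ⟨pb.basis.reindex (finCongr hdim), fun i => ?_⟩
    rw [Module.Basis.reindex_apply, pb.basis_eq_pow]
    rfl

theorem adjoinRoot_root_pow_eq_zero (A : Type*) [CommRing A] (j : ℕ) :
    AdjoinRoot.root (Polynomial.X ^ j : Polynomial A) ^ j = 0 := by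
  simpa using AdjoinRoot.eval₂_root (Polynomial.X ^ j : Polynomial A)

variable (k : Type*) [Field k]

theorem trace_jordan_mul_eq_finrankModPow (m : ℕ) (s : Multiset (ℕ × ℕ)) :
    trace k (jordan k m * (s.map (slot k)).prod) =
      finrankModPow k (boxSum k fun x : s => x.1) m :=
  trace_jordan_mul k m s

theorem jordan_mul_jordan_eq {i j : ℕ} {x : SlotRing k}
    (h : ∀ s : Multiset (ℕ × ℕ),
      (Module.finrank k (AdjoinRoot (Polynomial.X ^ j : Polynomial (Box k fun x : s => x.1)) ⧸
        Ideal.span {(algebraMap (Box k fun x : s => x.1)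
          (AdjoinRoot (Polynomial.X ^ j : Polynomial (Box k fun x : s => x.1)))
          (boxSum k fun x : s => x.1) + AdjoinRoot.root _) ^ i}) : ℤ) = trace k (x * (s.map (slot k)).prod)) :
    jordan k i * jordan k j = x :=
  slotRing_ext k fun s => by
    rw [trace_jordan_mul_jordan_mul, ← h s]
    rfl

theorem slot_two_eq (a : ℕ) : slot k (2 * a + 1, 2) = jordan k a + jordan k (a + 1) := by
  refine slotRing_ext k fun s => ?_
  have := box_finite (k := k) fun x : s => x.1
  obtain ⟨b, hb⟩ := exists_basis_adjoinRoot_X_pow (Box k fun x : s => x.1) (2 * a + 1)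
  rw [trace_slot_mul, add_mul, map_add, trace_jordan_mul_eq_finrankModPow,
    trace_jordan_mul_eq_finrankModPow]
  have := finrank_quotient_add_sq (k := k) (boxSum k fun x : s => x.1) b hb
    (adjoinRoot_root_pow_eq_zero _ _) a rfl
  exact_mod_cast this

variable (p : ℕ) [Fact p.Prime] [CharP k p] (e : ℕ)

/-- For j ≤ q, y^q = 0, so Frobenius gives (τ + y)^(qi) = τ^(qi), a scalar on a free module of rank
j. -/
theorem jordan_mul_jordan_of_le (i j : ℕ) (hj : j ≤ p ^ e) :
    jordan k (p ^ e * i) * jordan k j = j • jordan k (p ^ e * i) := by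
  refine jordan_mul_jordan_eq k fun s => ?_
  have := box_finite (k := k) fun x : s => x.1
  obtain ⟨b, hb⟩ := exists_basis_adjoinRoot_X_pow (Box k fun x : s => x.1) j
  rw [smul_mul_assoc, map_nsmul, trace_jordan_mul_eq_finrankModPow,
    finrank_quotient_pow (boxSum k fun x : s => x.1) b (p ^ e * i) _ ?_]
  · simp
  · rw [pow_mul, add_pow_prime_pow k p, pow_eq_zero_of_le (a := AdjoinRoot.root _) hj
      (adjoinRoot_root_pow_eq_zero _ _), add_zero, ← pow_mul]

theorem jordan_add_one_mul_jordan_of_le (i j : ℕ) (hj0 : 0 < j) (hj : j ≤ p ^ e) :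
    jordan k (p ^ e * i + 1) * jordan k j =
      jordan k (p ^ e * i + j) + (j - 1) • jordan k (p ^ e * i) := by
  refine jordan_mul_jordan_eq k fun s => ?_
  have := box_finite (k := k) fun x : s => x.1
  obtain ⟨b, hb⟩ := exists_basis_adjoinRoot_X_pow (Box k fun x : s => x.1) j
  rw [add_mul, map_add, smul_mul_assoc, map_nsmul, trace_jordan_mul_eq_finrankModPow,
    trace_jordan_mul_eq_finrankModPow, finrank_quotient_linear (boxSum k fun x : s => x.1) b hb
    (adjoinRoot_root_pow_eq_zero _ _) (p ^ e * i) _ ?_ hj0]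
  · simp
  · rw [pow_succ, pow_mul, add_pow_prime_pow k p, pow_eq_zero_of_le (a := AdjoinRoot.root _) hj
      (adjoinRoot_root_pow_eq_zero _ _), add_zero, ← pow_mul]

/-- Although y^q need not vanish here, its coefficient in (τ + y)^(qi) is a multiple of i, hence
zero. -/
theorem jordan_mul_jordan_add_one_of_eq_zero (i : ℕ) (hi : (i : k) = 0) :
    jordan k (p ^ e * i) * jordan k (p ^ e + 1) = (p ^ e + 1) • jordan k (p ^ e * i) := by
  obtain ⟨i, rfl⟩ | rfl : (∃ i', i = i' + 1) ∨ i = 0 := by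
    cases i with
    | zero => exact Or.inr rfl
    | succ i => exact Or.inl ⟨i, rfl⟩
  · refine jordan_mul_jordan_eq k fun s => ?_
    have := box_finite (k := k) fun x : s => x.1
    obtain ⟨b, hb⟩ := exists_basis_adjoinRoot_X_pow (Box k fun x : s => x.1) (p ^ e + 1)
    rw [smul_mul_assoc, map_nsmul, trace_jordan_mul_eq_finrankModPow,
      finrank_quotient_pow (boxSum k fun x : s => x.1) b (p ^ e * (i + 1)) _ ?_]
    · simp
    · rw [pow_mul_eq_of_pow_succ_eq_zero (pow_pos (Fact.out : p.Prime).pos e)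
        (adjoinRoot_root_pow_eq_zero _ _) (add_pow_prime_pow k p _ _ _),
        ← map_natCast (algebraMap k _), hi, map_zero, zero_mul, zero_mul, add_zero]
  · simp [jordan_zero]

theorem jordan_mul_jordan_add_one (i : ℕ) (hi : ((i + 1 : ℕ) : k) ≠ 0) :
    jordan k (p ^ e * (i + 1)) * jordan k (p ^ e + 1) = jordan k (p ^ e * (i + 2)) +
      jordan k (p ^ e * i) + (p ^ e - 1) • jordan k (p ^ e * (i + 1)) := by
  refine jordan_mul_jordan_eq k fun s => ?_
  have := box_finite (k := k) fun x : s => x.1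
  obtain ⟨b, hb⟩ := exists_basis_adjoinRoot_X_pow (Box k fun x : s => x.1) (p ^ e + 1)
  rw [add_mul, map_add, add_mul, map_add, smul_mul_assoc, map_nsmul,
    trace_jordan_mul_eq_finrankModPow, trace_jordan_mul_eq_finrankModPow,
    trace_jordan_mul_eq_finrankModPow, finrank_quotient_frobenius_mul _ b hb
    (adjoinRoot_root_pow_eq_zero _ _) (pow_pos (Fact.out : p.Prime).pos e)
    (add_pow_prime_pow k p _ _ _) i hi]
  simp

theorem jordan_add_mul_jordan_add_one (i m r : ℕ) (hm : 0 < m) (hr : 0 < r) (hq : m + r = p ^ e)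
    (hi : ((i + 1 : ℕ) : k) ≠ 0) (hi' : ((i + 2 : ℕ) : k) ≠ 0) :
    jordan k (p ^ e * (i + 1) + m) * jordan k (p ^ e + 1) = jordan k (p ^ e * i + m) +
      jordan k (p ^ e * (i + 1) + r) + jordan k (p ^ e * (i + 2) + m) +
      (m - 1) • jordan k (p ^ e * (i + 2)) + (r - 1) • jordan k (p ^ e * (i + 1)) := by
  rw [← hq]
  refine jordan_mul_jordan_eq k fun s => ?_
  have := box_finite (k := k) fun x : s => x.1
  obtain ⟨b, hb⟩ := exists_basis_adjoinRoot_X_pow (Box k fun x : s => x.1) (m + r + 1)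
  simp only [add_mul, map_add, smul_mul_assoc, map_nsmul, trace_jordan_mul_eq_finrankModPow]
  rw [← add_mul, finrank_quotient_frobenius _ b hb
    (adjoinRoot_root_pow_eq_zero _ _) hm hr (hq ▸ add_pow_prime_pow k p _ _ _) i hi hi']
  simp [add_mul]

theorem jordan_add_mul_jordan_add_one_of_eq_zero (i m r : ℕ) (hr : 0 < r)
    (hq : m + r = p ^ e) (hi : ((i + 1 : ℕ) : k) ≠ 0) (hi' : ((i + 2 : ℕ) : k) = 0) :
    jordan k (p ^ e * (i + 1) + m) * jordan k (p ^ e + 1) = jordan k (p ^ e * i + m) +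
      (m + 1) • jordan k (p ^ e * (i + 2)) + (r - 1) • jordan k (p ^ e * (i + 1)) := by
  rw [← hq]
  refine jordan_mul_jordan_eq k fun s => ?_
  have := box_finite (k := k) fun x : s => x.1
  obtain ⟨b, hb⟩ := exists_basis_adjoinRoot_X_pow (Box k fun x : s => x.1) (m + r + 1)
  simp only [add_mul, map_add, smul_mul_assoc, map_nsmul, trace_jordan_mul_eq_finrankModPow]
  rw [← add_mul, finrank_quotient_frobenius_of_eq_zero _ b hb
    (adjoinRoot_root_pow_eq_zero _ _) hr (hq ▸ add_pow_prime_pow k p _ _ _) i hi hi']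
  simp [add_mul]

end JordanRelations

end HilbertKunz

namespace HilbertKunz

/-! ### Path matrices and matrices commuting with them. -/

section PathMatrix

/-- The adjacency matrix of the path with `2a + 1` vertices, with loops of weight `ε` at both
ends. -/
def pathMatrix {R : Type*} [CommRing R] (a : ℕ) (ε : R) :
    Matrix (Fin (2 * a + 1)) (Fin (2 * a + 1)) R :=
  Matrix.of fun i j =>
    ((if (j : ℕ) = i + 1 then 1 else 0) + if (i : ℕ) = 2 * a ∧ j = i then ε else 0) +
      ((if (i : ℕ) = j + 1 then 1 else 0) + if (i : ℕ) = 0 ∧ j = i then ε else 0)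

theorem pathMatrix_mulVec {R : Type*} [CommRing R] (a : ℕ) (ε : R) (v : Fin (2 * a + 1) → R)
    (i : Fin (2 * a + 1)) : (pathMatrix a ε).mulVec v i =
      (if h : (i : ℕ) + 1 < 2 * a + 1 then v ⟨i + 1, h⟩ else ε * v i) +
        if h : 0 < (i : ℕ) then v ⟨i - 1, by omega⟩ else ε * v i := by
  simp only [Matrix.mulVec, dotProduct, pathMatrix, Matrix.of_apply, add_mul, Finset.sum_add_distrib]
  congr 1
  · split_ifs with h
    · rw [Finset.sum_eq_single (⟨i + 1, h⟩ : Fin (2 * a + 1)), Finset.sum_eq_zero]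
      · simp
      · intro j _
        rw [if_neg (by omega), zero_mul]
      · intro j _ hj
        rw [if_neg (fun h => hj (Fin.ext h)), zero_mul]
      · simp
    · rw [Finset.sum_eq_zero, Finset.sum_eq_single i]
      · rw [if_pos ⟨by omega, rfl⟩, zero_add]
      · intro j _ hj
        rw [if_neg (fun h => hj h.2), zero_mul]
      · simp
      · intro j _
        rw [if_neg (by omega), zero_mul]
  · split_ifs with h
    · rw [Finset.sum_eq_single (⟨i - 1, by omega⟩ : Fin (2 * a + 1)), Finset.sum_eq_zero]
      · rw [if_pos (by simp; omega)]; simp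
      · intro j _
        rw [if_neg (by omega), zero_mul]
      · intro j _ hj
        rw [if_neg (fun h => hj (Fin.ext (by simp; omega))), zero_mul]
      · simp
    · rw [Finset.sum_eq_zero, Finset.sum_eq_single i]
      · rw [if_pos ⟨by omega, rfl⟩, zero_add]
      · intro j _ hj
        rw [if_neg (fun h => hj h.2), zero_mul]
      · simp
      · intro j _
        rw [if_neg (by omega), zero_mul]

theorem pathMatrix_transpose {R : Type*} [CommRing R] (a : ℕ) (ε : R) :
    (pathMatrix a ε).transpose = pathMatrix a ε := by
  ext i j
  simp only [pathMatrix, Matrix.transpose_apply, Matrix.of_apply]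
  by_cases h : i = j
  · subst h; rfl
  · rw [if_neg (c := _ ∧ i = j) (fun h' => h h'.2), if_neg (c := _ ∧ i = j) (fun h' => h h'.2),
      if_neg (c := _ ∧ j = i) (fun h' => h h'.2.symm),
      if_neg (c := _ ∧ j = i) (fun h' => h h'.2.symm)]
    ring

theorem pathMatrix_map {R : Type*} [CommRing R] (a : ℕ) (ε : ℤ) :
    (Int.castRingHom R).mapMatrix (pathMatrix a ε) = pathMatrix a (ε : R) := by
  ext i j
  simp only [pathMatrix, RingHom.mapMatrix_apply, Matrix.map_apply, Matrix.of_apply]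
  simp

/-- Two symmetric matrices commute as soon as their product is symmetric. -/
theorem commute_pathMatrix_of_isSymm {a : ℕ} {ε : ℤ}
    {M : Matrix (Fin (2 * a + 1)) (Fin (2 * a + 1)) ℤ} (hM : M.transpose = M)
    (h : ∀ i j, (pathMatrix a ε).mulVec (fun l => M l j) i =
      (pathMatrix a ε).mulVec (fun l => M l i) j) :
    M * pathMatrix a ε = pathMatrix a ε * M := by
  have h1 : (pathMatrix a ε * M).transpose = pathMatrix a ε * M := by
    ext i j
    exact h j i
  rw [← h1, Matrix.transpose_mul, hM, pathMatrix_transpose]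

/-- A vector on which a path matrix acts as a scalar is determined by its first entry. -/
theorem eq_zero_of_pathMatrix_mulVec {R : Type*} [CommRing R] {a : ℕ} {ε g : R}
    {w : Fin (2 * a + 1) → R} (hw : g • w = (pathMatrix a ε).mulVec w) (h0 : w 0 = 0) : w = 0 := by
  have key : ∀ n (hn : n < 2 * a + 1), w ⟨n, hn⟩ = 0 := by
    intro n
    induction n using Nat.strong_induction_on with
    | _ n ih =>
      intro hn
      rcases n with _ | n
      · exact h0
      -- Row n of the eigenvector equation expresses entry n + 1 through the earlier entries.
      · have h1 := congrFun hw ⟨n, by omega⟩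
        rw [pathMatrix_mulVec, Pi.smul_apply, ih n (by omega), smul_zero, dif_pos hn] at h1
        rw [mul_zero] at h1
        split_ifs at h1 with h2
        · rw [ih (n - 1) (by omega), add_zero] at h1
          exact h1.symm
        · rw [add_zero] at h1
          exact h1.symm
  ext i
  exact key i i.2

/-- As M commutes with the path matrix, u z - M z is again a vector on which that matrix acts as g.
Its first entry vanishes, so u z = M z, and this iterates. -/
theorem pow_smul_eq_mulVec {R : Type*} [CommRing R] {a : ℕ} {ε : ℤ} {g u : R}
    {z : Fin (2 * a + 1) → R} (hz : g • z = (pathMatrix a (ε : R)).mulVec z)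
    {M : Matrix (Fin (2 * a + 1)) (Fin (2 * a + 1)) ℤ}
    (hM : M * pathMatrix a ε = pathMatrix a ε * M)
    (h0 : u * z 0 = ∑ j, (M 0 j : R) * z j) (n : ℕ) :
    u ^ n * z 0 = ∑ j, ((M ^ n) 0 j : R) * z j := by
  set φ := (Int.castRingHom R).mapMatrix (m := Fin (2 * a + 1)) with hφ
  have hz' : g • z = (φ (pathMatrix a ε)).mulVec z := by rw [hφ, pathMatrix_map, hz]
  have h1 : u • z - (φ M).mulVec z = 0 := by
    refine eq_zero_of_pathMatrix_mulVec (g := g) (ε := (ε : R)) ?_ ?_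
    · rw [← pathMatrix_map, smul_sub, Matrix.mulVec_sub, smul_comm g u, hz', Matrix.mulVec_smul,
        ← Matrix.mulVec_smul (φ M), hz', Matrix.mulVec_mulVec, Matrix.mulVec_mulVec, ← map_mul,
        ← map_mul, hM]
    · rw [Pi.sub_apply, Pi.smul_apply, smul_eq_mul, h0, sub_eq_zero]
      rfl
  have h2 : ∀ n, u ^ n • z = (φ (M ^ n)).mulVec z := by
    intro n
    induction n with
    | zero => simp
    | succ n ih =>
      rw [pow_succ, mul_smul, sub_eq_zero.mp h1, ← Matrix.mulVec_smul, ih, Matrix.mulVec_mulVec,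
        ← map_mul, pow_succ']
  exact congrFun (h2 n) 0

theorem T_transpose (a : ℕ) : (T a).transpose = T a := by
  ext i j
  simp only [T, Matrix.transpose_apply, Matrix.of_apply]
  split_ifs <;> omega

theorem N_transpose (a : ℕ) : (N a).transpose = N a := by
  ext i j
  simp only [N, Matrix.transpose_apply, Matrix.of_apply]
  split_ifs <;> omega

/-- Entrywise this is the discrete wave equation f(i+1,j) + f(i-1,j) = f(i,j+1) + f(i,j-1), with
values beyond the border reflected evenly. For `N` the reflection is odd, whence the loops -1. -/
theorem T_mul_pathMatrix (a : ℕ) : T a * pathMatrix a 1 = pathMatrix a 1 * T a := by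
  refine commute_pathMatrix_of_isSymm (T_transpose a) fun i j => ?_
  rw [pathMatrix_mulVec, pathMatrix_mulVec]
  obtain ⟨i, hi⟩ := i
  obtain ⟨j, hj⟩ := j
  simp only [T, Matrix.of_apply, one_mul]
  grind

theorem N_mul_pathMatrix (a : ℕ) : N a * pathMatrix a (-1) = pathMatrix a (-1) * N a := by
  refine commute_pathMatrix_of_isSymm (N_transpose a) fun i j => ?_
  rw [pathMatrix_mulVec, pathMatrix_mulVec]
  obtain ⟨i, hi⟩ := i
  obtain ⟨j, hj⟩ := j
  simp only [N, Matrix.of_apply, neg_mul, one_mul]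
  grind

end PathMatrix

end HilbertKunz

namespace HilbertKunz

/-! ### Three-term recursions for the products with the class of size q + 1. -/

section Recursion

variable (k : Type*) [Field k]

/-- The class `δ_{q i + 1} - δ_{q i}`. -/
noncomputable def jordanDiff (q i : ℕ) : SlotRing k := jordan k (q * i + 1) - jordan k (q * i)

/-- The class `δ_b + δ_{b + 1} - δ_{2 b + 1}`. -/
noncomputable def reducedSquare (b : ℕ) : SlotRing k :=
  jordan k b + jordan k (b + 1) - jordan k (2 * b + 1)

theorem finrank_box_of_isEmpty (v : (0 : Multiset (ℕ × ℕ)) → ℕ × ℕ) :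
    Module.finrank k (Box k v) = 1 := by
  have h : boxIdeal k v = ⊥ := by
    rw [boxIdeal, Set.range_eq_empty, Ideal.span_empty]
  rw [← ((AlgEquiv.quotientBot k (MvPolynomial (0 : Multiset (ℕ × ℕ)) k)).symm.trans
    (Ideal.quotientEquivAlgOfEq k h.symm)).toLinearEquiv.finrank_eq,
    (MvPolynomial.isEmptyAlgEquiv k (0 : Multiset (ℕ × ℕ))).toLinearEquiv.finrank_eq,
    Module.finrank_self]

theorem finrankModPow_of_pow_eq_zero {A : Type*} [CommRing A] [Algebra k A] {τ : A} {m : ℕ}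
    (h : τ ^ m = 0) : finrankModPow k τ m = Module.finrank k A := by
  rw [finrankModPow, h, Ideal.span_singleton_zero]
  exact (AlgEquiv.quotientBot k A).toLinearEquiv.finrank_eq

theorem trace_jordan {m : ℕ} (hm : 0 < m) : trace k (jordan k m) = 1 := by
  have h := trace_jordan_mul_eq_finrankModPow k m 0
  rw [Multiset.map_zero, Multiset.prod_zero, mul_one] at h
  rw [h, finrankModPow_of_pow_eq_zero, finrank_box_of_isEmpty, Nat.cast_one]
  rw [boxSum, Finset.univ_eq_empty, Finset.sum_empty, zero_pow hm.ne']

theorem jordan_one : jordan k 1 = 1 := by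
  refine slotRing_ext k fun s => ?_
  rw [trace_jordan_mul_eq_finrankModPow, one_mul, trace_prod, finrankModPow, pow_one]
  rfl

theorem reducedSquare_eq_zero {b : ℕ} (hb0 : b = 0) : reducedSquare k b = 0 := by
  subst hb0
  simp [reducedSquare, jordan_zero]

variable (p : ℕ) [Fact p.Prime] [CharP k p] (e : ℕ)

/-- In a product of classes of size at most q, Frobenius gives τ^q = 0. For i > 0 both τ^(qi) and
τ^(qi+1) then vanish, and the two cokernels have the same dimension. -/
theorem trace_jordanDiff_mul_eq_zero {i : ℕ} (hi : 0 < i) {x : SlotRing k}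
    (hx : x ∈ Algebra.adjoin ℤ {y | ∃ m ≤ p ^ e, y = jordan k m}) :
    trace k (jordanDiff k (p ^ e) i * x) = 0 := by
  have hs : ∀ x ∈ Submonoid.closure {y | ∃ m ≤ p ^ e, y = jordan k m},
      ∃ s : Multiset (ℕ × ℕ), (∀ a ∈ s, a.1 ≤ p ^ e ∧ a.2 = 1) ∧ x = (s.map (slot k)).prod := by
    intro x hx
    induction hx using Submonoid.closure_induction with
    | mem x hx =>
      obtain ⟨m, hm, rfl⟩ := hx
      exact ⟨{(m, 1)}, by simpa using hm, by simp [jordan]⟩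
    | one => exact ⟨0, by simp, by simp⟩
    | mul x y _ _ hx hy =>
      obtain ⟨s, hs, rfl⟩ := hx
      obtain ⟨t, ht, rfl⟩ := hy
      refine ⟨s + t, fun a ha => ?_, by simp⟩
      rcases Multiset.mem_add.mp ha with ha | ha
      exacts [hs a ha, ht a ha]
  have hx' : x ∈ Submodule.span ℤ
      (Submonoid.closure {y | ∃ m ≤ p ^ e, y = jordan k m} : Set (SlotRing k)) := by
    rw [← Algebra.adjoin_eq_span]; exact hx
  clear hx
  induction hx' using Submodule.span_induction with
  | mem x hx =>
    obtain ⟨s, hs, rfl⟩ := hs x hx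
    have hzero : (boxSum k fun x : s => x.1) ^ p ^ e = 0 := by
      have hsum : ∀ (t : Finset s), (∑ j ∈ t, boxVar k (fun x : s => x.1) j ^ j.1.2) ^ p ^ e =
          ∑ j ∈ t, (boxVar k (fun x : s => x.1) j ^ j.1.2) ^ p ^ e := by
        classical
        intro t
        induction t using Finset.induction_on with
        | empty => simp [(Fact.out : p.Prime).ne_zero]
        | insert j t hj ih => rw [Finset.sum_insert hj, Finset.sum_insert hj,
            add_pow_prime_pow k p, ih]
      rw [boxSum, hsum]
      refine Finset.sum_eq_zero fun j _ => ?_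
      have hj := hs j.1 (Multiset.coe_mem)
      rw [hj.2, pow_one]
      exact pow_eq_zero_of_le hj.1 (boxVar_pow k (fun x : s => x.1) j)
    have h1 : p ^ e ≤ p ^ e * i := Nat.le_mul_of_pos_right _ hi
    rw [jordanDiff, sub_mul, map_sub, trace_jordan_mul_eq_finrankModPow,
      trace_jordan_mul_eq_finrankModPow,
      finrankModPow_of_pow_eq_zero k (pow_eq_zero_of_le h1 hzero),
      finrankModPow_of_pow_eq_zero k (pow_eq_zero_of_le (h1.trans (Nat.le_succ _)) hzero), sub_self]
  | zero => rw [mul_zero, map_zero]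
  | add x y _ _ h1 h2 => rw [mul_add, map_add, h1, h2, add_zero]
  | smul c x _ h1 => rw [mul_smul_comm, map_zsmul, h1, smul_zero]

theorem jordanDiff_mul_jordan (i j : ℕ) (hj : j ≤ p ^ e) :
    jordanDiff k (p ^ e) i * jordan k j = jordan k (p ^ e * i + j) - jordan k (p ^ e * i) := by
  rcases Nat.eq_zero_or_pos j with rfl | hj0
  · simp [jordan_zero]
  · rw [jordanDiff, sub_mul, jordan_add_one_mul_jordan_of_le k p e i j hj0 hj,
      jordan_mul_jordan_of_le k p e i j hj]
    obtain ⟨j, rfl⟩ : ∃ j', j = j' + 1 := ⟨j - 1, by omega⟩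
    rw [Nat.add_sub_cancel, succ_nsmul]
    ring

/-- The sizes in R balance: b + (b + 1) - q = 0. -/
theorem jordan_mul_reducedSquare
    {b : ℕ} (hb : p ^ e = 2 * b + 1) (i : ℕ) : jordan k (p ^ e * i) * reducedSquare k b = 0 := by
  rw [reducedSquare, mul_sub, mul_add, ← hb, jordan_mul_jordan_of_le k p e i _ (by omega),
    jordan_mul_jordan_of_le k p e i _ (by omega), jordan_mul_jordan_of_le k p e i _ le_rfl,
    ← add_smul, ← sub_eq_zero.mpr rfl, show b + (b + 1) = p ^ e by omega]

theorem jordanDiff_mul_reducedSquare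
    {b : ℕ} (hb : p ^ e = 2 * b + 1) (i : ℕ) : jordanDiff k (p ^ e) i * reducedSquare k b =
    jordan k (p ^ e * i + b) + jordan k (p ^ e * i + (b + 1)) - jordan k (p ^ e * i) -
      jordan k (p ^ e * (i + 1)) := by
  rw [reducedSquare, mul_sub, mul_add, ← hb, jordanDiff_mul_jordan k p e i _ (by omega),
    jordanDiff_mul_jordan k p e i _ (by omega), jordanDiff_mul_jordan k p e i _ le_rfl,
    Nat.mul_succ]
  ring

/-- δ_q annihilates R, so on multiples of R the element D_1 acts as δ_(q+1). -/
theorem jordanDiff_one_mul_reducedSquare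
    {b : ℕ} (hb : p ^ e = 2 * b + 1) (x : SlotRing k) :
    jordanDiff k (p ^ e) 1 * (x * reducedSquare k b) =
      x * reducedSquare k b * jordan k (p ^ e + 1) := by
  have h := jordan_mul_reducedSquare k p e hb 1
  rw [mul_one] at h
  rw [jordanDiff, mul_one]
  linear_combination -x * h

/-- The product rule is applied to the remainders b and b + 1. As they add up to q, each is the
complementary remainder of the other, and the reflected terms reassemble into D_(i+1) R. -/
theorem jordanDiff_one_mul
    {b : ℕ} (hb : p ^ e = 2 * b + 1) (i : ℕ) (hi : ((i + 1 : ℕ) : k) ≠ 0) (hi' : ((i + 2 : ℕ) : k) ≠ 0) :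
    jordanDiff k (p ^ e) 1 * (jordanDiff k (p ^ e) (i + 1) * reducedSquare k b) =
      jordanDiff k (p ^ e) i * reducedSquare k b + jordanDiff k (p ^ e) (i + 1) * reducedSquare k b
        + jordanDiff k (p ^ e) (i + 2) * reducedSquare k b := by
  -- For q = 1 the remainder b is 0, outside the range of the product rule, but then R = 0.
  rcases Nat.eq_zero_or_pos b with hb0 | hb0
  · rw [reducedSquare_eq_zero k hb0]; simp
  · rw [jordanDiff_one_mul_reducedSquare k p e hb]
    simp only [jordanDiff_mul_reducedSquare k p e hb, sub_mul, add_mul]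
    rw [jordan_add_mul_jordan_add_one k p e i b (b + 1) hb0 (by omega) (by omega) hi hi',
      jordan_add_mul_jordan_add_one k p e i (b + 1) b (by omega) (by omega) (by omega) hi hi',
      jordan_mul_jordan_add_one k p e i hi, jordan_mul_jordan_add_one k p e (i + 1) hi',
      show i + 1 + 1 = i + 2 from rfl, show i + 1 + 2 = i + 2 + 1 from rfl, hb]
    obtain ⟨b, rfl⟩ : ∃ b', b = b' + 1 := ⟨b - 1, by omega⟩
    simp only [Nat.add_sub_cancel, nsmul_eq_mul]
    push_cast
    ring

theorem jordanDiff_one_mul_of_eq_zero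
    {b : ℕ} (hb : p ^ e = 2 * b + 1) (i : ℕ) (hi : ((i + 1 : ℕ) : k) ≠ 0)
    (hi' : ((i + 2 : ℕ) : k) = 0) :
    jordanDiff k (p ^ e) 1 * (jordanDiff k (p ^ e) (i + 1) * reducedSquare k b) =
      jordanDiff k (p ^ e) i * reducedSquare k b := by
  rcases Nat.eq_zero_or_pos b with hb0 | hb0
  · rw [reducedSquare_eq_zero k hb0]; simp
  · rw [jordanDiff_one_mul_reducedSquare k p e hb]
    simp only [jordanDiff_mul_reducedSquare k p e hb, sub_mul, add_mul]
    rw [jordan_add_mul_jordan_add_one_of_eq_zero k p e i b (b + 1) (by omega) (by omega) hi hi',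
      jordan_add_mul_jordan_add_one_of_eq_zero k p e i (b + 1) b (by omega) (by omega) hi hi',
      jordan_mul_jordan_add_one k p e i hi, jordan_mul_jordan_add_one_of_eq_zero k p e (i + 2) hi',
      show i + 1 + 1 = i + 2 from rfl, hb]
    obtain ⟨b, rfl⟩ : ∃ b', b = b' + 1 := ⟨b - 1, by omega⟩
    simp only [Nat.add_sub_cancel, nsmul_eq_mul]
    push_cast
    ring

end Recursion

/-! ### Traces of powers and the corner entries of T and N. -/

section Recursion

variable (k : Type*) [Field k]

theorem reducedSquare_mem_adjoin {q b : ℕ} (hb : q = 2 * b + 1) :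
    reducedSquare k b ∈ Algebra.adjoin ℤ {y | ∃ m ≤ q, y = jordan k m} := by
  refine Subalgebra.sub_mem _ (Subalgebra.add_mem _ ?_ ?_) ?_ <;>
    exact Algebra.subset_adjoin ⟨_, by omega, rfl⟩

theorem natCast_ne_zero_of_lt (p : ℕ) [CharP k p] {i : ℕ} (h0 : 0 < i) (hi : i < p) :
    (i : k) ≠ 0 := by
  rw [Ne, CharP.cast_eq_zero_iff k p]
  exact fun h => absurd (Nat.le_of_dvd h0 h) (by omega)

theorem jordanDiff_zero (q : ℕ) : jordanDiff k q 0 = 1 := by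
  simp [jordanDiff, jordan_zero, jordan_one]

variable (p : ℕ) [Fact p.Prime] [CharP k p] (e : ℕ) {a b : ℕ}

/-- Inner rows are the three-term recursion. The first loop -1 comes from D_0 = 1; the last occurs
because the recursion degenerates to D_1 z_i = z_(i-1) when i + 1 = p. -/
theorem smul_jordanDiff_eq_mulVec (hb : p ^ e = 2 * b + 1) (ha : p = 2 * a + 1) (ha0 : 0 < a) :
    (jordanDiff k (p ^ e) 1 - 1) • (fun i : Fin (2 * a + 1) =>
      jordanDiff k (p ^ e) i * reducedSquare k b) =
    (pathMatrix a ((-1 : ℤ) : SlotRing k)).mulVec fun i : Fin (2 * a + 1) =>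
      jordanDiff k (p ^ e) i * reducedSquare k b := by
  ext i
  obtain ⟨i, hi⟩ := i
  rw [pathMatrix_mulVec, Pi.smul_apply]
  simp only [smul_eq_mul, sub_mul, one_mul]
  rcases i with _ | i
  · rw [dif_pos (by omega), dif_neg (by omega)]
    simp [jordanDiff_zero]
    ring
  · have hi1 := natCast_ne_zero_of_lt k p (i := i + 1) (by omega) (by omega)
    rw [dif_pos (c := 0 < i + 1) (by omega)]
    by_cases hlast : i + 1 + 1 < 2 * a + 1
    · rw [dif_pos hlast, jordanDiff_one_mul k p e hb i hi1
        (natCast_ne_zero_of_lt k p (by omega) (by omega))]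
      simp only [Nat.add_sub_cancel]
      ring
    · have hi2 : ((i + 2 : ℕ) : k) = 0 := by
        rw [show i + 2 = p by omega, CharP.cast_eq_zero]
      rw [dif_neg hlast, jordanDiff_one_mul_of_eq_zero k p e hb i hi1 hi2]
      simp only [Nat.add_sub_cancel]
      push_cast
      ring

/-- Row 0 of N is the unit vector at a, so D_a acts as N on the vector (D_j R)_j. In the trace only
the term j = 0 survives. -/
theorem trace_pow_mul_reducedSquare_pow (hb : p ^ e = 2 * b + 1) (ha : p = 2 * a + 1)
    (ha0 : 0 < a) (n : ℕ) :
    trace k ((jordanDiff k (p ^ e) a * reducedSquare k b) ^ (n + 1)) =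
      (N a ^ (n + 1)) 0 0 * trace k (reducedSquare k b ^ (n + 1)) := by
  have key := pow_smul_eq_mulVec (u := jordanDiff k (p ^ e) a)
    (smul_jordanDiff_eq_mulVec k p e hb ha ha0) (N_mul_pathMatrix a) ?_ (n + 1)
  · have h1 : (jordanDiff k (p ^ e) a * reducedSquare k b) ^ (n + 1) =
        ∑ j : Fin (2 * a + 1), (N a ^ (n + 1)) 0 j •
          (jordanDiff k (p ^ e) j * reducedSquare k b ^ (n + 1)) := by
      rw [Fin.val_zero, jordanDiff_zero, one_mul] at key
      rw [mul_pow, pow_succ' (reducedSquare k b), ← mul_assoc, key, Finset.sum_mul]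
      refine Finset.sum_congr rfl fun j _ => ?_
      rw [zsmul_eq_mul]
      ring
    rw [h1, map_sum, Finset.sum_eq_single 0]
    · rw [map_zsmul, Fin.val_zero, jordanDiff_zero, one_mul, smul_eq_mul]
    · intro j _ hj
      rw [map_zsmul, trace_jordanDiff_mul_eq_zero k p e
        (Nat.pos_of_ne_zero fun h => hj (Fin.ext h))
        (Subalgebra.pow_mem _ (reducedSquare_mem_adjoin k hb) _), smul_zero]
    · simp
  · rw [Finset.sum_eq_single ⟨a, by omega⟩]
    · simp [N, jordanDiff_zero]
      omega
    · intro j _ hj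
      have hj' : (j : ℕ) ≠ a := fun h => hj (Fin.ext h)
      have : N a 0 j = 0 := by
        simp only [N, Matrix.of_apply, Fin.val_zero]
        split_ifs <;> omega
      rw [this, Int.cast_zero, zero_mul]
    · simp

theorem trace_jordan_sub_jordan (q : ℕ) (hq : 0 < q) (j : ℕ) :
    trace k (jordan k (q * (j + 1)) - jordan k (q * j)) = if j = 0 then 1 else 0 := by
  rw [map_sub, trace_jordan k (Nat.mul_pos hq j.succ_pos)]
  split_ifs with h
  · rw [h, mul_zero, jordan_zero, map_zero, sub_zero]
  · rw [trace_jordan k (Nat.mul_pos hq (Nat.pos_of_ne_zero h)), sub_self]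

/-- D_1 + 1 sends δ_(qi) to the sum of its neighbours for i < p and doubles δ_(qp). Taking
differences turns this, with δ_0 = 0, into loops 1 at both ends. -/
theorem smul_jordan_eq_mulVec (ha : p = 2 * a + 1) (ha0 : 0 < a) :
    (jordanDiff k (p ^ e) 1 + 1) • (fun i : Fin (2 * a + 1) =>
      jordan k (p ^ e * (i + 1)) - jordan k (p ^ e * i)) =
    (pathMatrix a ((1 : ℤ) : SlotRing k)).mulVec fun i : Fin (2 * a + 1) =>
      jordan k (p ^ e * (i + 1)) - jordan k (p ^ e * i) := by
  have hq : p ^ e = p ^ e - 1 + 1 := by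
    have := pow_pos (Fact.out : p.Prime).pos e
    omega
  have hle : ∀ i, jordan k (p ^ e) * jordan k (p ^ e * i) =
      (p ^ e - 1 : ℕ) • jordan k (p ^ e * i) + jordan k (p ^ e * i) := fun i => by
    rw [mul_comm, jordan_mul_jordan_of_le k p e i _ le_rfl, ← succ_nsmul, ← hq]
  have h1 : ∀ i, i + 1 < p → (jordanDiff k (p ^ e) 1 + 1) * jordan k (p ^ e * (i + 1)) =
      jordan k (p ^ e * (i + 2)) + jordan k (p ^ e * i) := fun i hi => by
    have := jordan_mul_jordan_add_one k p e i (natCast_ne_zero_of_lt k p (by omega) hi)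
    rw [jordanDiff, mul_one]
    linear_combination this - hle (i + 1)
  have h2 : (jordanDiff k (p ^ e) 1 + 1) * jordan k (p ^ e * (2 * a + 1)) =
      jordan k (p ^ e * (2 * a + 1)) + jordan k (p ^ e * (2 * a + 1)) := by
    have := jordan_mul_jordan_add_one_of_eq_zero k p e (2 * a + 1)
      (by rw [← ha, CharP.cast_eq_zero])
    rw [succ_nsmul, hq, succ_nsmul, ← hq] at this
    rw [jordanDiff, mul_one]
    linear_combination this - hle (2 * a + 1)
  ext i
  obtain ⟨i, hi⟩ := i
  rw [pathMatrix_mulVec, Pi.smul_apply]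
  simp only [smul_eq_mul, Int.cast_one, one_mul, mul_sub]
  rcases i with _ | i
  · rw [dif_pos (by omega), dif_neg (by omega), h1 0 (by omega), mul_zero, jordan_zero]
    ring_nf
  · rw [dif_pos (c := 0 < i + 1) (by omega), h1 i (by omega)]
    simp only [Nat.add_sub_cancel]
    by_cases hlast : i + 1 + 1 < 2 * a + 1
    · rw [dif_pos hlast, h1 (i + 1) (by omega)]
      ring_nf
    · rw [dif_neg hlast, show i + 1 + 1 = 2 * a + 1 by omega, h2]
      ring

/-- Row 0 of T is 2 before position a, 1 at a and 0 after, so the sum telescopes to 2 f(a) + (f(a+1)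
- f(a)). -/
theorem sum_T_mul {R : Type*} [CommRing R] (a : ℕ) (f : ℕ → R) (h0 : f 0 = 0) :
    ∑ j : Fin (2 * a + 1), (T a 0 j : R) * (f (j + 1) - f j) = f a + f (a + 1) := by
  have h1 : ∀ j : Fin (2 * a + 1), (T a 0 j : R) * (f (j + 1) - f j) =
      (fun j : ℕ => ((if j < a then 2 else if a < j then 0 else 1 : ℤ) : R) * (f (j + 1) - f j)) j := by
    intro j
    have : T a 0 j = if (j : ℕ) < a then 2 else if a < (j : ℕ) then 0 else 1 := by
      simp only [T, Matrix.of_apply, Fin.val_zero]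
      split_ifs <;> omega
    rw [this]
  rw [Finset.sum_congr rfl fun j _ => h1 j, ← Finset.sum_range
    (fun j : ℕ => ((if j < a then 2 else if a < j then 0 else 1 : ℤ) : R) * (f (j + 1) - f j)),
    show 2 * a + 1 = a + 1 + a by ring,
    Finset.sum_range_add, Finset.sum_range_succ,
    Finset.sum_congr (s₁ := Finset.range a) (g := fun j => 2 * (f (j + 1) - f j)) rfl
      fun j hj => by simp [Finset.mem_range.mp hj],
    ← Finset.mul_sum, Finset.sum_range_sub, Finset.sum_eq_zero]
  · simp [h0]
    ring
  · intro j _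
    rw [if_neg (by omega), if_pos (by omega)]
    simp

/-- The first entry of the vector is δ_q, and I δ_q = q I; hence I acts on the vector as qT. -/
theorem trace_jordan_add_jordan_pow (ha : p = 2 * a + 1) (ha0 : 0 < a) (n : ℕ) :
    trace k ((jordan k (p ^ e * a) + jordan k (p ^ e * (a + 1))) ^ (n + 1)) =
      (p ^ e : ℕ) ^ n * (T a ^ (n + 1)) 0 0 := by
  have hq := pow_pos (Fact.out : p.Prime).pos e
  set I := jordan k (p ^ e * a) + jordan k (p ^ e * (a + 1)) with hI
  have hIq : I * jordan k (p ^ e) = p ^ e • I := by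
    rw [hI, add_mul, jordan_mul_jordan_of_le k p e _ _ le_rfl,
      jordan_mul_jordan_of_le k p e _ _ le_rfl, ← smul_add]
  have hcomm : ((p ^ e : ℕ) : ℤ) • T a * pathMatrix a 1 =
      pathMatrix a 1 * ((p ^ e : ℕ) : ℤ) • T a := by
    rw [Matrix.smul_mul, Matrix.mul_smul, T_mul_pathMatrix]
  have key := pow_smul_eq_mulVec (u := I) (smul_jordan_eq_mulVec k p e ha ha0) hcomm ?_ (n + 1)
  · simp only [Fin.val_zero, mul_zero, jordan_zero, sub_zero, zero_add, mul_one] at key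
    -- I^(n+1) δ_q = q I^(n+1): this q cancels one of the n + 1 factors in (qT)^(n+1), leaving q^n.
    rw [pow_succ, mul_assoc, hIq, mul_smul_comm, ← pow_succ] at key
    have h1 := congrArg (trace k) key
    rw [map_nsmul, map_sum, Finset.sum_eq_single 0] at h1
    · rw [← zsmul_eq_mul, map_zsmul, trace_jordan_sub_jordan k _ hq, if_pos (Fin.val_zero _),
        smul_pow,
        Matrix.smul_apply] at h1
      simp only [nsmul_eq_mul, smul_eq_mul, mul_one] at h1
      have hq' : ((p ^ e : ℕ) : ℤ) ≠ 0 := by exact_mod_cast hq.ne'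
      refine mul_left_cancel₀ hq' (h1.trans ?_)
      ring
    · intro j _ hj
      rw [← zsmul_eq_mul, map_zsmul, trace_jordan_sub_jordan k _ hq,
        if_neg (fun h : (j : ℕ) = 0 => hj (Fin.ext h)), smul_zero]
    · simp
  · have h2 := sum_T_mul a (fun j => jordan k (p ^ e * j)) (by simp [jordan_zero])
    simp only [Fin.val_zero, mul_zero, jordan_zero, sub_zero, zero_add, mul_one]
    rw [hIq, hI, ← h2, Finset.smul_sum]
    refine Finset.sum_congr rfl fun j _ => ?_
    rw [Matrix.smul_apply, smul_eq_mul, Int.cast_mul, nsmul_eq_mul, Int.cast_natCast, mul_assoc]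

theorem add_pow_succ_of_mul_eq_zero {R : Type*} [CommRing R] {x y : R} (h : x * y = 0) (n : ℕ) :
    (x + y) ^ (n + 1) = x ^ (n + 1) + y ^ (n + 1) := by
  induction n with
  | zero => simp
  | succ n ih =>
    rw [pow_succ, ih]
    linear_combination (x ^ n + y ^ n) * h

/-- S_q = R + δ_q is a sum with product zero, and δ_q^(n+1) = q^n δ_q has trace q^n. -/
theorem trace_slot_pow_eq (hb : p ^ e = 2 * b + 1) (n : ℕ) :
    trace k (slot k (p ^ e, 2) ^ (n + 1)) =
      trace k (reducedSquare k b ^ (n + 1)) + (p ^ e : ℕ) ^ n := by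
  have hq := pow_pos (Fact.out : p.Prime).pos e
  have h1 : slot k (p ^ e, 2) = reducedSquare k b + jordan k (p ^ e) := by
    rw [reducedSquare, hb, slot_two_eq]; ring
  have h2 : ∀ n, jordan k (p ^ e) ^ (n + 1) = (p ^ e) ^ n • jordan k (p ^ e) := by
    intro n
    induction n with
    | zero => simp
    | succ n ih =>
      have := jordan_mul_jordan_of_le k p e 1 _ le_rfl
      rw [mul_one] at this
      rw [pow_succ, ih, smul_mul_assoc, this, ← mul_smul, pow_succ]
  have h3 : reducedSquare k b * jordan k (p ^ e) = 0 := by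
    have := jordan_mul_reducedSquare k p e hb 1
    rwa [mul_one, mul_comm] at this
  rw [h1, add_pow_succ_of_mul_eq_zero h3, map_add, h2, map_nsmul, trace_jordan k hq]
  simp

/-- The recursion for the number of Jordan blocks. -/
theorem trace_slot_pow_succ (ha : p = 2 * a + 1) (ha0 : 0 < a) (n : ℕ) :
    trace k (slot k (p ^ (e + 1), 2) ^ (n + 1)) = (p ^ e : ℕ) ^ n * (T a ^ (n + 1)) 0 0 +
      (N a ^ (n + 1)) 0 0 * (trace k (slot k (p ^ e, 2) ^ (n + 1)) - (p ^ e : ℕ) ^ n) := by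
  obtain ⟨b, hb⟩ : ∃ b, p ^ e = 2 * b + 1 :=
    (Odd.pow (⟨a, ha⟩ : Odd p) : Odd (p ^ e))
  have hb' : p ^ (e + 1) = 2 * (p ^ e * a + b) + 1 := by
    rw [pow_succ]
    nth_rw 2 [ha]
    rw [mul_add, mul_one]
    nth_rw 2 [hb]
    ring
  -- The halves of pq = 2 (qa + b) + 1 are qa + b and qa + b + 1; these are the leading terms of D_a
  -- R, whose other two terms are cancelled by I.
  have h1 : slot k (p ^ (e + 1), 2) = (jordan k (p ^ e * a) + jordan k (p ^ e * (a + 1))) +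
      jordanDiff k (p ^ e) a * reducedSquare k b := by
    rw [jordanDiff_mul_reducedSquare k p e hb, hb', slot_two_eq, add_assoc (p ^ e * a)]
    ring
  have h2 : (jordan k (p ^ e * a) + jordan k (p ^ e * (a + 1))) *
      (jordanDiff k (p ^ e) a * reducedSquare k b) = 0 := by
    linear_combination jordanDiff k (p ^ e) a *
      (jordan_mul_reducedSquare k p e hb a + jordan_mul_reducedSquare k p e hb (a + 1))
  rw [h1, add_pow_succ_of_mul_eq_zero h2, map_add, trace_jordan_add_jordan_pow k p e ha ha0,
    trace_pow_mul_reducedSquare_pow k p e hb ha ha0, trace_slot_pow_eq k p e hb]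
  ring

theorem trace_slot_one_pow (n : ℕ) : trace k (slot k (1, 2) ^ n) = 1 := by
  have : slot k (1, 2) = 1 := by
    have := slot_two_eq k 0
    rwa [jordan_zero, zero_add, zero_add, jordan_one] at this
  rw [this, one_pow, ← jordan_one, trace_jordan k one_pos]

end Recursion

end HilbertKunz

/-! ### Lengths over the power series quotient as dimensions of truncated polynomial algebras. -/

namespace HilbertKunz

/-- Over an algebra with the same residue field, lengths can be computed over the base. -/
theorem length_eq_length_of_residue (k : Type*) [Field k] {R : Type*} [CommRing R] [IsLocalRing R]
    [Algebra k R] (hres : ∀ x : R, ∃ c : k, x - algebraMap k R c ∈ IsLocalRing.maximalIdeal R)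
    (M : Type*) [AddCommGroup M] [Module R M] [Module k M] [IsScalarTower k R M] :
    Module.length R M = Module.length k M := by
  have hsurj : Function.Surjective
      (algebraMap (IsLocalRing.ResidueField k) (IsLocalRing.ResidueField R)) := by
    intro y
    obtain ⟨x, rfl⟩ := IsLocalRing.residue_surjective y
    obtain ⟨c, hc⟩ := hres x
    refine ⟨IsLocalRing.residue k c, ?_⟩
    exact (Ideal.Quotient.eq.mpr hc).symm
  have hone : Module.length (IsLocalRing.ResidueField k) (IsLocalRing.ResidueField R) = 1 := by
    rw [Module.length_eq_of_surjective (R := IsLocalRing.ResidueField R) hsurj, Module.length_eq_one]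
  rw [IsLocalRing.length_restrictScalars k R M, hone, mul_one]

section PowerSeries

open MvPowerSeries

theorem mem_span_X_pow_iff {σ k : Type*} [Finite σ] [Field k] (q : ℕ) (f : MvPowerSeries σ k) :
    f ∈ Ideal.span (Set.range fun i => (X i : MvPowerSeries σ k) ^ q) ↔
      ∀ m : σ →₀ ℕ, (∀ i, m i < q) → coeff m f = 0 := by
  classical
  have := Fintype.ofFinite σ
  refine ⟨fun hf m hm => ?_, fun hf => ?_⟩
  · rw [Ideal.mem_span_range_iff_exists_fun] at hf
    obtain ⟨c, rfl⟩ := hf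
    rw [map_sum]
    exact Finset.sum_eq_zero fun i _ => X_pow_dvd_iff.mp (dvd_mul_left _ _) m (hm i)
  -- Each exponent vector with some entry at least q is assigned to one chosen such variable. This
  -- splits f into parts g_i divisible by X_i^q.
  · let g : σ → MvPowerSeries σ k := fun i m =>
      if h : ∃ j, q ≤ m j then if h.choose = i then coeff m f else 0 else 0
    have hg : ∀ i m, coeff m (g i) =
        if h : ∃ j, q ≤ m j then if h.choose = i then coeff m f else 0 else 0 := fun _ _ => rfl
    have hsum : f = ∑ i, g i := by
      ext m
      simp only [map_sum, hg]
      by_cases h : ∃ j, q ≤ m j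
      · simp [h]
      · simp only [h, dite_false, Finset.sum_const_zero]
        exact hf m (by simpa using h)
    rw [hsum]
    refine Ideal.sum_mem _ fun i _ => ?_
    have : (X i : MvPowerSeries σ k) ^ q ∣ g i := by
      refine X_pow_dvd_iff.mpr fun m hm => ?_
      rw [hg]
      split_ifs with h h'
      · have := h.choose_spec
        rw [h'] at this
        omega
      · rfl
      · rfl
    exact Ideal.mem_of_dvd _ this (Ideal.subset_span ⟨i, rfl⟩)

theorem maximalIdeal_mvPowerSeries (σ k : Type*) [Finite σ] [Field k] :
    IsLocalRing.maximalIdeal (MvPowerSeries σ k) =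
      Ideal.span (Set.range fun i => (X i : MvPowerSeries σ k)) := by
  ext f
  have := mem_span_X_pow_iff (σ := σ) (k := k) 1 f
  simp only [pow_one] at this
  rw [this, IsLocalRing.mem_maximalIdeal, mem_nonunits_iff, isUnit_iff_constantCoeff,
    isUnit_iff_ne_zero, not_not]
  refine ⟨fun h m hm => ?_, fun h => by simpa using h 0 (by simp)⟩
  have : m = 0 := by
    ext i
    simpa using hm i
  simpa [this] using h

theorem maximalIdeal_quadric (k : Type*) [Field k] (d : ℕ) :
    IsLocalRing.maximalIdeal (Quadric k d) =
      Ideal.span (Set.range fun i => Ideal.Quotient.mk (Ideal.span {quadricEq k d}) (X i)) := by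
  rw [← IsLocalRing.map_maximalIdeal_of_surjective
      (Ideal.Quotient.mk (Ideal.span {quadricEq k d})) Ideal.Quotient.mk_surjective,
    maximalIdeal_mvPowerSeries,
    Ideal.map_span, ← Set.range_comp]
  rfl

theorem frobeniusPower_span {R ι : Type*} [CommRing R] (p : ℕ) [Fact p.Prime] [CharP R p]
    [Finite ι] (x : ι → R) (e : ℕ) :
    frobeniusPower (Ideal.span (Set.range x)) (p ^ e) =
      Ideal.span (Set.range fun i => x i ^ p ^ e) := by
  have := Fintype.ofFinite ι
  apply le_antisymm
  · rw [frobeniusPower, Ideal.span_le]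
    rintro _ ⟨y, hy, rfl⟩
    obtain ⟨c, rfl⟩ := Ideal.mem_span_range_iff_exists_fun.mp hy
    rw [sum_pow_char_pow]
    refine Ideal.sum_mem _ fun i _ => ?_
    rw [mul_pow]
    exact Ideal.mul_mem_left _ _ (Ideal.subset_span ⟨i, rfl⟩)
  · rw [Ideal.span_le]
    rintro _ ⟨i, rfl⟩
    exact Ideal.subset_span ⟨x i, Ideal.subset_span ⟨i, rfl⟩, rfl⟩

theorem boxIdeal_mem_iff {σ k : Type*} [Field k] (v : σ → ℕ × ℕ) (f : MvPolynomial σ k) :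
    f ∈ boxIdeal k v ↔ ∀ m : σ →₀ ℕ, (∀ i, m i < (v i).1) → f.coeff m = 0 := by
  have h : boxIdeal k v = Ideal.span ((fun s => MvPolynomial.monomial s (1 : k)) ''
      Set.range fun i => Finsupp.single i (v i).1) := by
    rw [boxIdeal, ← Set.range_comp]
    congr! 2
    ext1 i
    simp [MvPolynomial.X_pow_eq_monomial]
  rw [h, MvPolynomial.mem_ideal_span_monomial_image]
  refine forall_congr' fun m => ?_
  rw [MvPolynomial.mem_support_iff]
  simp only [Set.exists_range_iff, Finsupp.single_le_iff]
  rw [not_imp_comm]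
  simp

/-- Truncated polynomials as a quotient of the power series ring. -/
noncomputable def boxEquivPowerSeries (σ k : Type*) [Finite σ] [Field k] (q c : ℕ) :
    Box k (fun _ : σ => (q, c)) ≃ₐ[k]
      MvPowerSeries σ k ⧸ Ideal.span (Set.range fun i => (X i : MvPowerSeries σ k) ^ q) :=
  (Ideal.quotientEquivAlgOfEq k (by
    ext f
    rw [boxIdeal_mem_iff, RingHom.mem_ker]
    change _ ↔ Ideal.Quotient.mk _ (f : MvPowerSeries σ k) = 0
    rw [Ideal.Quotient.eq_zero_iff_mem, mem_span_X_pow_iff]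
    simp)).trans
  (Ideal.quotientKerAlgEquivOfSurjective
    (f := (Ideal.Quotient.mkₐ k _).comp (MvPolynomial.coeToMvPowerSeries.algHom k)) (by
    classical
    have := Fintype.ofFinite σ
    intro y
    obtain ⟨f, rfl⟩ := Ideal.Quotient.mk_surjective y
    -- The truncation keeps exponents up to q itself; the extra monomials lie in the ideal anyway.
    refine ⟨trunc' k (Finsupp.equivFunOnFinite.symm fun _ => q) f, ?_⟩
    refine Ideal.Quotient.eq.mpr ((mem_span_X_pow_iff q _).mpr fun m hm => ?_)
    have hle : m ≤ Finsupp.equivFunOnFinite.symm fun _ => q := fun i => (hm i).le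
    simp [coeff_trunc', hle]))

theorem boxEquivPowerSeries_boxVar (σ k : Type*) [Finite σ] [Field k] (q c : ℕ) (i : σ) :
    boxEquivPowerSeries σ k q c (boxVar k _ i) = Ideal.Quotient.mk _ (X i) := by
  change Ideal.Quotient.mk _ ((MvPolynomial.X i : MvPolynomial σ k) : MvPowerSeries σ k) = _
  rw [MvPolynomial.coe_X]

end PowerSeries

end HilbertKunz

namespace HilbertKunz

/-! ### The Hilbert-Kunz lengths and the dimension of the quadric. -/

section PowerSeries

open MvPowerSeries

theorem boxDim_const (k : Type*) [Field k] (n q c : ℕ) :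
    (boxDim k fun _ : Fin n => (q, c) : ℤ) = trace k (slot k (q, c) ^ n) := by
  have h := trace_prod k (Multiset.replicate n (q, c))
  rw [Multiset.map_replicate, Multiset.prod_replicate] at h
  rw [h, slotDim]
  have hcard : Fintype.card (Fin n) = Fintype.card (Multiset.replicate n (q, c)) := by simp
  rw [boxDim_congr (Fintype.equivOfCardEq hcard) (fun _ => (q, c)) _ fun i =>
    Multiset.eq_of_mem_replicate (Multiset.coe_mem)]

/-- The truncated polynomial ring modulo the sum of squares, as a quotient of the power series
ring modulo the sum of squares. -/
noncomputable def boxQuotientEquiv (k : Type*) [Field k] (p d : ℕ) [Fact p.Prime] [CharP k p]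
    (e : ℕ) :
    (Box k (fun _ : Fin (d + 1) => (p ^ e, 2)) ⧸
      Ideal.span {boxSum k fun _ : Fin (d + 1) => (p ^ e, 2)}) ≃ₐ[k]
      Quadric k d ⧸ frobeniusPower (IsLocalRing.maximalIdeal (Quadric k d)) (p ^ e) :=
  ((Ideal.quotientEquivAlg _
    ((Ideal.span {quadricEq k d}).map (Ideal.Quotient.mkₐ k
      (Ideal.span (Set.range fun i => (X i : MvPowerSeries (Fin (d + 1)) k) ^ p ^ e))))
    (boxEquivPowerSeries (Fin (d + 1)) k (p ^ e) 2) (by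
      rw [Ideal.map_span, Ideal.map_span, Set.image_singleton, Set.image_singleton]
      congr 2
      rw [quadricEq, boxSum]
      simp only [map_sum, map_pow]
      refine Finset.sum_congr rfl fun i _ => ?_
      congr 1
      exact (boxEquivPowerSeries_boxVar _ _ _ _ i).symm)).trans
    (DoubleQuot.quotQuotEquivCommₐ k _ _)).trans
    (Ideal.quotientEquivAlgOfEq k (by
      rw [maximalIdeal_quadric, frobeniusPower_span, Ideal.map_span, ← Set.range_comp]
      rfl))

/-- Subtracting the constant term lands in the maximal ideal, so the residue field is k and length
is k-dimension. -/
theorem hkLength_quadric (k : Type*) [Field k] (p d : ℕ) [Fact p.Prime] [CharP k p] (e : ℕ) :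
    hkLength p (Quadric k d) e = boxDim k fun _ : Fin (d + 1) => (p ^ e, 2) := by
  have hfin := box_finite (k := k) fun _ : Fin (d + 1) => (p ^ e, 2)
  rw [hkLength, length_eq_length_of_residue k, ← (boxQuotientEquiv k p d e).toLinearEquiv.length_eq,
    Module.length_eq_finrank, boxDim]
  intro x
  obtain ⟨f, rfl⟩ := Ideal.Quotient.mk_surjective x
  refine ⟨constantCoeff f, ?_⟩
  rw [← IsLocalRing.map_maximalIdeal_of_surjective
    (Ideal.Quotient.mk (Ideal.span {quadricEq k d})) Ideal.Quotient.mk_surjective]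
  have : Ideal.Quotient.mk (Ideal.span {quadricEq k d}) f - algebraMap k (Quadric k d)
      (constantCoeff f) = Ideal.Quotient.mk _ (f - C (constantCoeff f)) := rfl
  rw [this]
  refine Ideal.mem_map_of_mem _ ?_
  rw [IsLocalRing.mem_maximalIdeal, mem_nonunits_iff, isUnit_iff_constantCoeff]
  simp

/-- The n variables generate the maximal ideal, which bounds the dimension above; each added power
series variable raises it by at least one. -/
theorem ringKrullDim_mvPowerSeries_fin (k : Type*) [Field k] (n : ℕ) :
    ringKrullDim (MvPowerSeries (Fin n) k) = n := by
  apply le_antisymm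
  · refine (ringKrullDim_le_spanFinrank_maximalIdeal _).trans ?_
    rw [maximalIdeal_mvPowerSeries]
    have h := Submodule.spanFinrank_span_le_ncard_of_finite (R := MvPowerSeries (Fin n) k)
      (Set.finite_range fun i : Fin n => (X i : MvPowerSeries (Fin n) k))
    have h' := Set.ncard_image_le (f := fun i : Fin n => (X i : MvPowerSeries (Fin n) k))
      Set.finite_univ
    rw [Set.image_univ, Set.ncard_univ, Nat.card_eq_fintype_card, Fintype.card_fin] at h'
    exact_mod_cast h.trans h'
  · induction n with
    | zero => exact ringKrullDim_nonneg_of_nontrivial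
    | succ n ih =>
      rw [ringKrullDim_eq_of_ringEquiv (finSuccEquiv k n).toRingEquiv]
      refine le_trans ?_ ringKrullDim_succ_le_ringKrullDim_powerseries
      rw [Nat.cast_add, Nat.cast_one]
      exact add_le_add_left ih 1

/-- The equation is a nonzero nonunit in a domain, so the dimension drops by exactly one.
Nonvanishing is seen at the coefficient of x_0^2. -/
theorem ringKrullDim_quadric (k : Type*) [Field k] (d : ℕ) :
    ringKrullDim (Quadric k d) = d := by
  have hne : quadricEq k d ≠ 0 := by
    classical
    intro h
    have h1 := congrArg (coeff (Finsupp.single 0 2)) h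
    simp only [quadricEq, map_sum, coeff_X_pow, map_zero] at h1
    rw [Finset.sum_eq_single 0] at h1
    · simp at h1
    · intro i _ hi
      rw [if_neg]
      intro h2
      have := DFunLike.congr_fun h2 0
      simp [hi] at this
    · simp
  have h := ringKrullDim_quotient_span_singleton_succ_eq_ringKrullDim_of_mem_nonZeroDivisors
    (mem_nonZeroDivisors_of_ne_zero hne)
    (by rw [IsLocalRing.mem_maximalIdeal, mem_nonunits_iff, isUnit_iff_constantCoeff]
        simp [quadricEq])
  rw [ringKrullDim_mvPowerSeries_fin, Nat.cast_add, Nat.cast_one] at h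
  exact ENat.WithBot.add_one_cancel.mp h

end PowerSeries

end HilbertKunz

/-! ### Solving the recursion and passing to the limit. -/

namespace HilbertKunz

theorem N_pow_succ_nonneg_le (a m : ℕ) (i j : Fin (2 * a + 1)) :
    0 ≤ (N a ^ (m + 1)) i j ∧ (N a ^ (m + 1)) i j ≤ (2 * a + 1 : ℤ) ^ m := by
  have hN : ∀ i j, 0 ≤ N a i j ∧ N a i j ≤ 1 := by
    intro i j
    simp only [N, Matrix.of_apply]
    split_ifs <;> simp
  induction m generalizing i j with
  | zero => simpa using hN i j
  | succ m ih =>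
    rw [pow_succ, Matrix.mul_apply]
    refine ⟨Finset.sum_nonneg fun l _ => mul_nonneg (ih i l).1 (hN l j).1, ?_⟩
    calc ∑ l, (N a ^ (m + 1)) i l * N a l j ≤ ∑ _l : Fin (2 * a + 1), (2 * a + 1 : ℤ) ^ m :=
          Finset.sum_le_sum fun l _ =>
            (mul_le_of_le_one_right (ih i l).1 (hN l j).2).trans (ih i l).2
      _ = (2 * a + 1 : ℤ) ^ (m + 1) := by
          rw [Finset.sum_const, Finset.card_univ, Fintype.card_fin, nsmul_eq_mul, pow_succ]
          push_cast
          ring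

/-- Row 0 of N is a unit vector, which saves a factor 2a + 1 over the trivial bound when d > 0. For
d = 0 the corner entry is 0 because a > 0. -/
theorem N_pow_apply_zero_lt (a d : ℕ) (ha : 0 < a) :
    (N a ^ (d + 1)) 0 0 < (2 * a + 1 : ℤ) ^ d := by
  rcases d with _ | d
  · simp [N, ha]
  · have hrow : (N a ^ (d + 2)) 0 0 = (N a ^ (d + 1)) ⟨a, by omega⟩ 0 := by
      rw [pow_succ', Matrix.mul_apply, Finset.sum_eq_single ⟨a, by omega⟩]
      · have : N a 0 ⟨a, by omega⟩ = 1 := by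
          simp [N, ha]
        rw [this, one_mul]
      · intro j _ hj
        have hja : (j : ℕ) ≠ a := fun h => hj (Fin.ext h)
        have : N a 0 j = 0 := by
          simp only [N, Matrix.of_apply, Fin.val_zero]
          split_ifs <;> omega
        rw [this, zero_mul]
      · simp
    rw [hrow]
    exact (N_pow_succ_nonneg_le a d _ 0).2.trans_lt
      (pow_lt_pow_right₀ (by omega) (Nat.lt_succ_self d))

/-- With P = p^d, the hypothesis on c says that c P^e is a particular solution of the recursion. The
homogeneous solutions are multiples of N'^e, and length 1 at e = 0 fixes the coefficient 1 - c. -/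
theorem toNat_hkLength_quadric (k : Type*) [Field k] (p a d : ℕ) [Fact p.Prime] [CharP k p]
    (ha : p = 2 * a + 1) (ha0 : 0 < a) {c : ℝ}
    (hc : c * ((p : ℝ) ^ d - ((N a ^ (d + 1)) 0 0 : ℤ)) =
      ((T a ^ (d + 1)) 0 0 : ℤ) - ((N a ^ (d + 1)) 0 0 : ℤ)) (e : ℕ) :
    ((hkLength p (Quadric k d) e).toNat : ℝ) =
      c * ((p : ℝ) ^ d) ^ e + (1 - c) * (((N a ^ (d + 1)) 0 0 : ℤ) : ℝ) ^ e := by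
  have htrace : ((hkLength p (Quadric k d) e).toNat : ℝ) =
      (trace k (slot k (p ^ e, 2) ^ (d + 1)) : ℤ) := by
    rw [hkLength_quadric, ENat.toNat_natCast, ← boxDim_const, Int.cast_natCast]
  rw [htrace]
  clear htrace
  induction e with
  | zero => simp [trace_slot_one_pow]
  | succ e ih =>
    rw [trace_slot_pow_succ k p e ha ha0]
    push_cast
    rw [ih]
    linear_combination (-(p : ℝ) ^ (d * e)) * hc

theorem hasHKMultiplicity_quadric (k : Type*) [Field k] (p a d : ℕ) [Fact p.Prime] [CharP k p]
    (ha : p = 2 * a + 1) (ha0 : 0 < a) :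
    HasHKMultiplicity p (Quadric k d) (1 + ((((T a ^ (d + 1)) 0 0 : ℤ) : ℝ) - (p : ℝ) ^ d) /
        ((p : ℝ) ^ d - (((N a ^ (d + 1)) 0 0 : ℤ) : ℝ))) := by
  have hP : (0 : ℝ) < (p : ℝ) ^ d := pow_pos (Nat.cast_pos.mpr (Fact.out : p.Prime).pos) d
  have hlt : (((N a ^ (d + 1)) 0 0 : ℤ) : ℝ) < (p : ℝ) ^ d := by
    have := N_pow_apply_zero_lt a d ha0
    rw [ha]
    exact_mod_cast this
  have h0 : (0 : ℝ) ≤ (((N a ^ (d + 1)) 0 0 : ℤ) : ℝ) := by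
    exact_mod_cast (N_pow_succ_nonneg_le a d 0 0).1
  refine ⟨d, ringKrullDim_quadric k d, fun e => ?_, ?_⟩
  · rw [hkLength_quadric]
    exact ENat.natCast_ne_top _
  · set P := (p : ℝ) ^ d with hPdef
    set n := (((N a ^ (d + 1)) 0 0 : ℤ) : ℝ)
    set c := 1 + ((((T a ^ (d + 1)) 0 0 : ℤ) : ℝ) - P) / (P - n) with hcdef
    have hne : P - n ≠ 0 := (sub_pos.mpr hlt).ne'
    have hc : c * (P - n) = (((T a ^ (d + 1)) 0 0 : ℤ) : ℝ) - n := by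
      rw [hcdef]
      field_simp
      ring
    have hlim : Tendsto (fun e : ℕ => c + (1 - c) * (n / P) ^ e) atTop (𝓝 (c + (1 - c) * 0)) :=
      ((tendsto_pow_atTop_nhds_zero_of_lt_one (div_nonneg h0 hP.le)
        ((div_lt_one hP).mpr hlt)).const_mul _).const_add _
    rw [mul_zero, add_zero] at hlim
    refine hlim.congr fun e => ?_
    rw [toNat_hkLength_quadric k p a d ha ha0 hc e, mul_comm e d, pow_mul, ← hPdef, div_pow]
    have := pow_ne_zero e hP.ne'
    field_simp
    rfl

end HilbertKunz
theorem mainTheorem10 (p : ℕ) [Fact p.Prime] (hp : 2 < p) (a : ℕ) (ha : a = (p - 1) / 2)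
    (d : ℕ) (k : Type*) [Field k] [CharP k p] :
    (∃ c, HilbertKunz.HasHKMultiplicity p (HilbertKunz.A p d) c) ∧
    (∃ c, HilbertKunz.HasHKMultiplicity p (HilbertKunz.Quadric k d) c) ∧
    HilbertKunz.eHK p (HilbertKunz.A p d) = HilbertKunz.eHK p (HilbertKunz.Quadric k d) ∧
    (p : ℝ) ^ d - (((HilbertKunz.N a ^ (d + 1)) 0 0 : ℤ) : ℝ) ≠ 0 ∧
    HilbertKunz.eHK p (HilbertKunz.Quadric k d) =
      1 + ((((HilbertKunz.T a ^ (d + 1)) 0 0 : ℤ) : ℝ) - (p : ℝ) ^ d) /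
        ((p : ℝ) ^ d - (((HilbertKunz.N a ^ (d + 1)) 0 0 : ℤ) : ℝ)) := by
  have hodd : p = 2 * a + 1 := by
    have := (Fact.out : p.Prime).eq_two_or_odd
    omega
  have ha0 : 0 < a := by omega
  have hA := HilbertKunz.hasHKMultiplicity_quadric (ZMod p) p a d hodd ha0
  have hk := HilbertKunz.hasHKMultiplicity_quadric k p a d hodd ha0
  refine ⟨⟨_, hA⟩, ⟨_, hk⟩, hA.eHK_eq.trans hk.eHK_eq.symm, ?_, hk.eHK_eq⟩
  have hlt := HilbertKunz.N_pow_apply_zero_lt a d ha0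
  rw [sub_ne_zero, hodd]
  exact_mod_cast hlt.ne'
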